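/- A word $w=w_1\cdots w_m$ in positive integers is *reduced* if no shorter word $u$ satisfies $s_{u_1}\cdots s_{u_k}=s_{w_1}\cdots s_{w_m}$, where $s_a=(a\ a{+}1)$; it is a reduced word of $\sigma=s_{w_1}\cdots s_{w_m}$. Reading $w$ from left to right and starting from the identity in one-line notation, the letter $w_l$ exchanges the values in positions $w_l$ and $w_l+1$; these are the two values *swapped* at $l$. An *inversion* of $\sigma$ is a pair of positions $i<j$ with $\sigma_i>\sigma_j$; a *descent* is an inversion of the form $(i,i+1)$. A word is *Grassmannian* if it is a reduced word of a permutation $\sigma=a_1\cdots a_k b_1b_2\cdots$ with exactly one descent, at position $k$. For such a word $w$ of length $m$, $\mathrm{Tab}(w)$ is the tableau with rows indexed by $a_k,a_{k-1},\dots,a_1$ and columns by $b_1,b_2,\dots$, which has the entry $m+1-l$ in row $a_i$ and column $b_j$ if $w_l$ swaps $a_i$ and $b_j$, and no other entries. Let $w$ be reduced, and let $i$ be such that deleting $w_i$ leaves a reduced word. The *Little bump* $w{\uparrow_i}$ is obtained as follows. Replace $w_i$ by $w_i-1$ if $w_i>1$; if $w_i=1$, instead add $1$ to all the other letters. If the resulting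 word is reduced, stop. Otherwise there is exactly one other index $j\ne i$ at which the same two values are swapped as at $i$; repeat the procedure at $j$, and so on until the word is reduced. The *Little map* $\mathrm{LS}$ is defined recursively on nonempty reduced words: if $w$ is Grassmannian, then $\mathrm{LS}(w)=\mathrm{Tab}(w)$; otherwise $\mathrm{LS}(w)=\mathrm{LS}(w{\uparrow_i})$, where $(r,s)$ is the lexicographically last inversion of the permutation $\sigma$ of $w$ and $w_i$ is the letter that swaps the values $\sigma_r$ and $\sigma_s$. **Corollary (Little's Conjecture 11).** Let $w$ be a reduced word and let $\uparrow_{i_1},\dots,\uparrow_{i_p}$ be any finite sequence of Little bumps such that $v=w{\uparrow_{i_1}}\cdots{\uparrow_{i_p}}$ is a Grassmannian word. Then the recursion defining $\mathrm{LS}(w)$ terminates and $\mathrm{Tab}(v)=\mathrm{LS}(w)$. -/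

import Mathlib

namespace Little

/-- The adjacent transposition `s_a = (a a+1)`, as a permutation of `ℕ`. Permutations of
`{1, …, n}` are regarded as permutations of `ℕ` fixing `0` and every number larger than `n`. -/
def simple (a : ℕ) : Equiv.Perm ℕ := Equiv.swap a (a + 1)

/-- The product `s_{w_1} s_{w_2} ⋯ s_{w_m}` of a word. In one-line notation, right
multiplication by `s_a` exchanges the values in positions `a` and `a + 1`. -/
def perm (w : List ℕ) : Equiv.Perm ℕ := (w.map simple).prod

/-- Reduced words: the letters are positive, and no word in the generators `s_1, s_2, …` with
the same product is shorter. -/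
def IsReduced (w : List ℕ) : Prop :=
  (∀ a ∈ w, 1 ≤ a) ∧
    ∀ u : List ℕ, (∀ a ∈ u, 1 ≤ a) → perm u = perm w → w.length ≤ u.length

/-- Inversions of a permutation: pairs of positions `1 ≤ i < j` with `σ i > σ j`. -/
def IsInversion (σ : Equiv.Perm ℕ) (i j : ℕ) : Prop := 1 ≤ i ∧ i < j ∧ σ j < σ i

/-- Descents: inversions of the form `(i, i + 1)`. -/
def IsDescent (σ : Equiv.Perm ℕ) (i : ℕ) : Prop := IsInversion σ i (i + 1)

/-- Grassmannian words: reduced words of permutations with exactly one descent. -/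
def IsGrassmannian (w : List ℕ) : Prop := IsReduced w ∧ ∃! k, IsDescent (perm w) k

/-- The pair of values exchanged by the letter at index `l` of `w`, where indices start at `0`:
reading the word from left to right and starting from the identity, this letter `a` exchanges
the values that then stand in positions `a` and `a + 1`. Only used for `l < w.length`. -/
def swapped (w : List ℕ) (l : ℕ) : Sym2 ℕ :=
  s(perm (w.take l) (w.getD l 0), perm (w.take l) (w.getD l 0 + 1))

/-- Fillings of the cells `(row, column)`, with indices from `0`; the value `0` marks a cell
outside the shape. -/
abbrev Tableau : Type := ℕ → ℕ → ℕ

/-- The tableau of a Grassmannian word `w` of length `m`. Let `k` be the descent of the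
permutation `a_1 ⋯ a_k b_1 b_2 ⋯` of `w`. The rows are indexed by `a_k, …, a_1` and the columns
by `b_1, b_2, …`; if `a_i` and `b_j` are exchanged by the letter at index `l` (from `0`), the
entry in row `a_i` and column `b_j` is `m - l`. -/
noncomputable def tab (w : List ℕ) : Tableau := fun r c =>
  let k := sInf {i | IsDescent (perm w) i}
  if r < k then
    match (List.range w.length).find?
        (fun l => decide (swapped w l = s(perm w (k - r), perm w (k + 1 + c)))) with
    | some l => w.length - l
    | none => 0
  else 0

/-- The word `w^{(i-)}`: decrement the letter at index `i` if it is larger than `1`; otherwise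
keep it and increment all the other letters. -/
def decrement (w : List ℕ) (i : ℕ) : List ℕ :=
  if 1 < w.getD i 0 then w.set i (w.getD i 0 - 1) else (w.map (· + 1)).set i (w.getD i 0)

/-- The iteration in a Little bump: `BumpsTo u j v` says that decrementing at index `j` of `u`,
and then, as long as the word is not reduced, at the other index where the same two values are
exchanged as at the index just decremented, ends in the reduced word `v`. -/
inductive BumpsTo : List ℕ → ℕ → List ℕ → Prop
  | done (u : List ℕ) (j : ℕ) (h : IsReduced (decrement u j)) :
      BumpsTo u j (decrement u j)
  | next (u : List ℕ) (j j' : ℕ) (v : List ℕ) (h : ¬ IsReduced (decrement u j))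
      (hlt : j' < u.length) (hne : j' ≠ j)
      (hswap : swapped (decrement u j) j' = swapped (decrement u j) j)
      (hv : BumpsTo (decrement u j) j' v) : BumpsTo u j v

/-- `v` is the result of the Little bump on the reduced word `w` beginning at index `i`; such a
bump may be started only where removing the letter leaves a reduced word. -/
def IsLittleBump (w : List ℕ) (i : ℕ) (v : List ℕ) : Prop :=
  IsReduced w ∧ i < w.length ∧ IsReduced (w.eraseIdx i) ∧ BumpsTo w i v

/-- `(r, s)` is the lexicographically last inversion of `σ`. -/
def IsLastInversion (σ : Equiv.Perm ℕ) (r s : ℕ) : Prop :=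
  IsInversion σ r s ∧ ∀ r' s', IsInversion σ r' s' → r' < r ∨ (r' = r ∧ s' ≤ s)

/-- The graph of the Little map: `IsLS w T` says that the recursion defining `LS(w)` halts with
output `T`. On a Grassmannian word the output is its tableau; on any other reduced word the
recursion continues with the Little bump at the index where the two values of the last
inversion are exchanged. -/
inductive IsLS : List ℕ → Tableau → Prop
  | grassmannian (w : List ℕ) (h : IsGrassmannian w) : IsLS w (tab w)
  | bump (w : List ℕ) (r s i : ℕ) (v : List ℕ) (T : Tableau) (hw : ¬ IsGrassmannian w)
      (hrs : IsLastInversion (perm w) r s)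
      (hi : swapped w i = s(perm w r, perm w s))
      (hv : IsLittleBump w i v) (hT : IsLS v T) : IsLS w T

end Little

/-!
The recursion defining `LS(w)` is a sequence of Little bumps, so it suffices to show that it halts
and that any two Grassmannian words reached from `w` by Little bumps have the same tableau.

**Integer words.** Adding a constant to all letters of a word only shifts its permutation, so words
are taken over `ℤ`, where a bump lowers letters and never has to raise the others (`ZBump`). A word
is reduced iff no pair of values is exchanged twice (`isReduced_iff`); this rests on the fact that
a pair of values is inverted iff it is exchanged an odd number of times
(`not_inverted_iff_even_count`).

**The invariant.** A bump preserves the descents of a word, i.e. the places `l` with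
`w_l > w_{l+1}`: as soon as it makes two adjacent letters equal, the other one is lowered next
(`ZBump.lt_iff`). A bump also commutes with each Coxeter–Knuth move `ckMove l` on three adjacent
letters (`ZBump.map_ckMove`): outside the three letters the exchanged pairs are unaffected by the
move, and inside them the two bumps are compared directly (`CKRule.localMatch`). Hence bumps
preserve the descents seen after any sequence of Coxeter–Knuth moves (`SameDescents`), and so no
insertion algorithm is needed.

**Grassmannian words.** Two Grassmannian words with the same invariant agree up to a shift of the
letters (`GrassmannianAt.eq_of_sameDescents`), by induction on the length: if they differ in the
first letter only, say `a < b`, then some letter strictly between `a` and `b` can be moved to the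
second place by Coxeter–Knuth moves (`GrassmannianAt.exists_ckMoves`), where it distinguishes `a`
and `b`. A shift of the letters does not change the tableau (`tab_map_add`).

**Termination.** During a bump, the word without the letter just lowered remains a reduced word of
one permutation, which bounds the letters from below (`NearlyReduced.exists_settles`). A bump from
the last inversion `(r, s)` turns the permutation `τ` of that word into `τ (q r)` for some `q < r`
(`Settles.exists_split`, `ZReduced.not_between`). Over `ℤ` this lowers the last inversion
lexicographically, while the permutation stays increasing up to any position `f < r` where it was
(`ZReduced.exists_step`). When `r` comes down to `f`, the word is Grassmannian.
-/

namespace Little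

/-! ### Words over the integers and their crossings -/

/-- The adjacent transposition `(a a+1)` of `ℤ`. -/
def zsimple (a : ℤ) : Equiv.Perm ℤ := Equiv.swap a (a + 1)

/-- The product of the adjacent transpositions indexed by the letters of an integer word. -/
def zperm (w : List ℤ) : Equiv.Perm ℤ := (w.map zsimple).prod

/-- The list of the pairs of values exchanged by the successive letters of a word. -/
def crossings : List ℤ → List (Sym2 ℤ)
  | [] => []
  | a :: t => s(a, a + 1) :: (crossings t).map (Sym2.map (zsimple a))

/-- An integer word is reduced if no pair of values is exchanged twice. That this agrees with
minimality of the length is `ZReduced.length_le` and `exists_sublist_of_not_zreduced`. -/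
def ZReduced (w : List ℤ) : Prop := (crossings w).Nodup

/-- The values `p ≠ q` occur in `σ` in the order opposite to their natural one. -/
def Inverted (σ : Equiv.Perm ℤ) (p q : ℤ) : Prop := ¬ (p < q ↔ σ⁻¹ p < σ⁻¹ q)

theorem zsimple_apply (a x : ℤ) :
    zsimple a x = if x = a then a + 1 else if x = a + 1 then a else x := by
  simp [zsimple, Equiv.swap_apply_def]

@[simp] theorem zsimple_zsimple (a x : ℤ) : zsimple a (zsimple a x) = x := by
  simp [zsimple]

@[simp] theorem zsimple_inv (a : ℤ) : (zsimple a)⁻¹ = zsimple a := by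
  simp [zsimple]

@[simp] theorem zperm_nil : zperm [] = 1 := rfl

@[simp] theorem zperm_cons (a : ℤ) (t : List ℤ) : zperm (a :: t) = zsimple a * zperm t := by
  simp [zperm]

@[simp] theorem zperm_append (X Y : List ℤ) : zperm (X ++ Y) = zperm X * zperm Y := by
  simp [zperm]

@[simp] theorem crossings_nil : crossings [] = [] := rfl

@[simp] theorem crossings_cons (a : ℤ) (t : List ℤ) :
    crossings (a :: t) = s(a, a + 1) :: (crossings t).map (Sym2.map (zsimple a)) := rfl

@[simp] theorem length_crossings (w : List ℤ) : (crossings w).length = w.length := by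
  induction w with
  | nil => rfl
  | cons a t ih => simp [ih]

theorem crossings_append (X Y : List ℤ) :
    crossings (X ++ Y) = crossings X ++ (crossings Y).map (Sym2.map (zperm X)) := by
  induction X with
  | nil => simp
  | cons a t ih =>
    simp only [List.cons_append, crossings_cons, ih, List.map_append, List.map_map, zperm_cons]
    congr 3
    funext z
    induction z with | _ x y => simp

theorem crossings_append_cons (X : List ℤ) (a : ℤ) (Y : List ℤ) :
    crossings (X ++ a :: Y) = crossings X ++ s(zperm X a, zperm X (a + 1)) ::
      (crossings Y).map (Sym2.map (zperm X * zsimple a)) := by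
  rw [crossings_append]
  simp only [crossings_cons, List.map_cons, Sym2.map_mk, List.map_map]
  congr 3
  funext z
  induction z with | _ x y => simp

theorem swap_eq_swap_of_mk_eq {p q p' q' : ℤ} (h : s(p, q) = s(p', q')) :
    Equiv.swap p q = Equiv.swap p' q' := by
  rcases Sym2.eq_iff.1 h with ⟨rfl, rfl⟩ | ⟨rfl, rfl⟩
  · rfl
  · exact Equiv.swap_comm _ _

theorem zperm_mul_zsimple (X : List ℤ) (a : ℤ) :
    zperm X * zsimple a = Equiv.swap (zperm X a) (zperm X (a + 1)) * zperm X := by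
  rw [zsimple, Equiv.mul_swap_eq_swap_mul]

theorem zperm_append_cons (X : List ℤ) (a : ℤ) (Y : List ℤ) :
    zperm (X ++ a :: Y) =
      Equiv.swap (zperm X a) (zperm X (a + 1)) * zperm (X ++ Y) := by
  rw [zperm_append, zperm_cons, ← mul_assoc, zperm_mul_zsimple, zperm_append, mul_assoc]

theorem map_swap_mk (p q : ℤ) : Sym2.map (Equiv.swap p q) s(p, q) = s(p, q) := by
  simp [Sym2.eq_swap]

theorem map_injective (σ : Equiv.Perm ℤ) : Function.Injective (Sym2.map σ) :=
  Sym2.map.injective σ.injective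

/-! ### Parity of the crossings of a pair of values -/

theorem not_inverted_iff_even_count (w : List ℤ) : ∀ {p q : ℤ}, p ≠ q →
    (¬ Inverted (zperm w) p q ↔ Even ((crossings w).count s(p, q))) := by
  induction w with
  | nil => intro p q _; simp [Inverted]
  | cons a t ih =>
    intro p q hpq
    have h := @ih (zsimple a p) (zsimple a q) (by simpa using hpq)
    have hc : ((crossings t).map (Sym2.map (zsimple a))).count s(p, q)
        = (crossings t).count s(zsimple a p, zsimple a q) := by
      rw [← List.count_map_of_injective (crossings t) _ (map_injective (zsimple a))
        s(zsimple a p, zsimple a q), Sym2.map_mk, zsimple_zsimple, zsimple_zsimple]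
    rw [crossings_cons, List.count_cons, hc, Nat.even_add, ← h]
    simp only [Inverted, zperm_cons, mul_inv_rev, zsimple_inv, Equiv.Perm.mul_apply, beq_iff_eq]
    have key : (s(a, a + 1) = s(p, q)) ↔ ¬ (zsimple a p < zsimple a q ↔ p < q) := by
      rw [Sym2.eq_iff]
      simp only [zsimple_apply]
      split_ifs <;> omega
    split_ifs with h1
    · rw [key] at h1
      simp only [Nat.not_even_one, iff_false]
      tauto
    · rw [key] at h1
      simp only [Even.zero, iff_true]
      tauto

theorem mem_crossings_of_inverted {w : List ℤ} {p q : ℤ} (hpq : p ≠ q)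
    (h : Inverted (zperm w) p q) : s(p, q) ∈ crossings w := by
  by_contra hn
  have := (not_inverted_iff_even_count w hpq).2 (by simp [List.count_eq_zero_of_not_mem hn])
  exact this h

theorem ne_of_mem_crossings {w : List ℤ} : ∀ {p q : ℤ}, s(p, q) ∈ crossings w → p ≠ q := by
  induction w with
  | nil => simp
  | cons a t ih =>
    intro p q h
    rw [crossings_cons, List.mem_cons] at h
    rcases h with h | h
    · rcases Sym2.eq_iff.1 h with h | h <;> omega
    · have : s(zsimple a p, zsimple a q) ∈ crossings t := by
        obtain ⟨z, hz, hz2⟩ := List.mem_map.1 h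
        rwa [show s(zsimple a p, zsimple a q) = z from
          map_injective (zsimple a) (by simp [hz2])]
      simpa using ih this

theorem ZReduced.inverted_of_mem {w : List ℤ} (hw : ZReduced w) {p q : ℤ}
    (h : s(p, q) ∈ crossings w) : Inverted (zperm w) p q := by
  by_contra hn
  have := (not_inverted_iff_even_count w (ne_of_mem_crossings h)).1 hn
  rw [List.count_eq_one_of_mem hw h] at this
  exact absurd this (by decide)

theorem ZReduced.mem_iff {w : List ℤ} (hw : ZReduced w) {p q : ℤ} (hpq : p ≠ q) :
    s(p, q) ∈ crossings w ↔ Inverted (zperm w) p q :=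
  ⟨hw.inverted_of_mem, mem_crossings_of_inverted hpq⟩

/-! ### Reduced words are the shortest ones -/

/-- The crossings of a reduced word are the inversions of its permutation, and these are
crossings of every word of that permutation. -/
theorem ZReduced.length_le {w u : List ℤ} (hw : ZReduced w) (h : zperm u = zperm w) :
    w.length ≤ u.length := by
  have hs : crossings w ⊆ crossings u := by
    intro z hz
    induction z with | _ p q =>
    exact mem_crossings_of_inverted (ne_of_mem_crossings hz) (h ▸ hw.inverted_of_mem hz)
  simpa using (hw.subperm hs).length_le

theorem exists_split_of_getElem? {w : List ℤ} {j : ℕ} {p q : ℤ}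
    (h : (crossings w)[j]? = some s(p, q)) :
    ∃ X a Y, w = X ++ a :: Y ∧ X.length = j ∧ s(zperm X a, zperm X (a + 1)) = s(p, q) := by
  have hj : j < w.length := by
    have := (List.getElem?_eq_some_iff.1 h).1
    simpa using this
  refine ⟨w.take j, w[j], w.drop (j + 1), by simp, by simp; omega, ?_⟩
  rw [show w = w.take j ++ w[j] :: w.drop (j + 1) by simp, crossings_append_cons,
    List.getElem?_append_right (by simp)] at h
  simpa [Nat.min_eq_left hj.le] using h

theorem exists_split_of_mem {w : List ℤ} {p q : ℤ} (h : s(p, q) ∈ crossings w) :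
    ∃ X a Y, w = X ++ a :: Y ∧ s(zperm X a, zperm X (a + 1)) = s(p, q) := by
  obtain ⟨j, hj⟩ := List.mem_iff_getElem?.1 h
  obtain ⟨X, a, Y, h1, -, h2⟩ := exists_split_of_getElem? hj
  exact ⟨X, a, Y, h1, h2⟩

theorem zperm_erase_of_split {X Y : List ℤ} {a p q : ℤ}
    (h : s(zperm X a, zperm X (a + 1)) = s(p, q)) :
    zperm (X ++ Y) = Equiv.swap p q * zperm (X ++ a :: Y) := by
  rw [zperm_append_cons, swap_eq_swap_of_mk_eq h, ← mul_assoc, Equiv.swap_mul_self, one_mul]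

theorem exists_sublist_of_not_zreduced {w : List ℤ} (hw : ¬ ZReduced w) :
    ∃ u, u.Sublist w ∧ zperm u = zperm w ∧ u.length + 2 = w.length := by
  induction w with
  | nil => exact absurd List.nodup_nil hw
  | cons a t ih =>
    rw [ZReduced, crossings_cons, List.nodup_cons,
      List.nodup_map_iff (map_injective (zsimple a)), not_and_or, not_not] at hw
    rcases hw with h | h
    · have : s(a, a + 1) ∈ crossings t := by
        obtain ⟨z, hz, hz2⟩ := List.mem_map.1 h
        rwa [show s(a, a + 1) = z from map_injective (zsimple a) (by
          rw [hz2]; simp [zsimple_apply, Sym2.eq_swap])]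
      obtain ⟨X, b, Y, rfl, hb⟩ := exists_split_of_mem this
      refine ⟨X ++ Y, ?_, ?_, by simp; omega⟩
      · exact ((List.Sublist.refl X).append (List.sublist_cons_self b Y)).cons a
      · rw [zperm_erase_of_split hb, zperm_cons, zsimple]
    · obtain ⟨u, h1, h2, h3⟩ := ih h
      exact ⟨a :: u, h1.cons_cons a, by simp [h2], by simp [← h3]⟩

theorem ZReduced.of_zperm_eq {w u : List ℤ} (hw : ZReduced w) (h : zperm u = zperm w)
    (hl : u.length = w.length) : ZReduced u := by
  by_contra hu
  obtain ⟨x, -, hx, hxl⟩ := exists_sublist_of_not_zreduced hu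
  have := hw.length_le (hx.trans h)
  omega

theorem ZReduced.of_append_left {X Y : List ℤ} (h : ZReduced (X ++ Y)) : ZReduced X := by
  rw [ZReduced, crossings_append] at h
  exact h.of_append_left

theorem ZReduced.of_append_right {X Y : List ℤ} (h : ZReduced (X ++ Y)) : ZReduced Y := by
  rw [ZReduced, crossings_append] at h
  exact List.Nodup.of_map _ h.of_append_right

theorem zreduced_iff_getElem? {w : List ℤ} : ZReduced w ↔
    ∀ i j, i < j → j < w.length → (crossings w)[i]? ≠ (crossings w)[j]? := by
  rw [ZReduced, List.nodup_iff_getElem?_ne_getElem?]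
  simp

theorem ZReduced.index_unique {w : List ℤ} (hw : ZReduced w) {i j : ℕ} (hi : i < w.length)
    (hj : j < w.length) (h : (crossings w)[i]? = (crossings w)[j]?) : i = j := by
  rcases lt_trichotomy i j with hij | hij | hij
  · exact absurd h (zreduced_iff_getElem?.1 hw i j hij hj)
  · exact hij
  · exact absurd h.symm (zreduced_iff_getElem?.1 hw j i hij hi)

/-! ### Words that become reduced when a letter is removed -/

/-- If removing a letter leaves a reduced word, then the word is itself reduced unless the pair
of values exchanged by the letter is also exchanged elsewhere. -/
theorem mem_crossings_of_not_zreduced {X Y : List ℤ} {a : ℤ} (he : ZReduced (X ++ Y))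
    (hu : ¬ ZReduced (X ++ a :: Y)) :
    s(zperm X a, zperm X (a + 1)) ∈ crossings (X ++ Y) := by
  have hne : zperm X a ≠ zperm X (a + 1) := by simp
  set p := zperm X a with hp
  set q := zperm X (a + 1) with hq
  by_contra hn
  rw [he.mem_iff hne, Inverted, not_not] at hn
  obtain ⟨u, -, hu1, hu2⟩ := exists_sublist_of_not_zreduced hu
  have hinv : Inverted (zperm u) p q := by
    rw [hu1, zperm_append_cons, ← hp, ← hq]
    simp only [Inverted, mul_inv_rev, Equiv.swap_inv, Equiv.Perm.mul_apply,
      Equiv.swap_apply_left, Equiv.swap_apply_right]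
    have : (zperm (X ++ Y))⁻¹ p ≠ (zperm (X ++ Y))⁻¹ q := by simpa using hne
    omega
  obtain ⟨X', b, Y', rfl, hb⟩ := exists_split_of_mem (mem_crossings_of_inverted hne hinv)
  have h1 := zperm_erase_of_split (Y := Y') hb
  rw [hu1, ← zperm_erase_of_split (X := X) (Y := Y) (a := a) (p := p) (q := q) rfl] at h1
  have := he.length_le h1
  simp at this hu2
  omega

/-! ### Bumps of integer words -/

/-- Lower the letter at index `j` by one. -/
def dec (w : List ℤ) (j : ℕ) : List ℤ := w.set j (w.getD j 0 - 1)

/-- Removing the letter at index `j` leaves a reduced word. -/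
def NearlyReduced (w : List ℤ) (j : ℕ) : Prop := j < w.length ∧ ZReduced (w.eraseIdx j)

/-- `Settles n y j v`: a bump which has just lowered the letter at index `j` and thereby reached
the word `y` lowers `n` more letters and ends with the reduced word `v`. -/
inductive Settles : ℕ → List ℤ → ℕ → List ℤ → Prop
  | done (y : List ℤ) (j : ℕ) (h : ZReduced y) : Settles 0 y j y
  | next (n : ℕ) (y : List ℤ) (j j' : ℕ) (v : List ℤ) (h : ¬ ZReduced y) (hlt : j' < y.length)
      (hne : j' ≠ j) (hc : (crossings y)[j']? = (crossings y)[j]?)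
      (hv : Settles n (dec y j') j' v) : Settles (n + 1) y j v

/-- `v` results from the reduced word `w` by a bump, without any renormalization of letters. -/
def ZBump (w v : List ℤ) : Prop :=
  ZReduced w ∧ ∃ i n, NearlyReduced w i ∧ Settles n (dec w i) i v

@[simp] theorem length_dec (w : List ℤ) (j : ℕ) : (dec w j).length = w.length := by
  simp [dec]

theorem dec_append_cons (X : List ℤ) (a : ℤ) (Y : List ℤ) :
    dec (X ++ a :: Y) X.length = X ++ (a - 1) :: Y := by
  simp [dec]

theorem dec_append_left {X Y : List ℤ} {j : ℕ} (h : j < X.length) :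
    dec (X ++ Y) j = dec X j ++ Y := by
  simp [dec, h, List.getElem?_append_left h]

theorem dec_append_right (X Y : List ℤ) (j : ℕ) :
    dec (X ++ Y) (X.length + j) = X ++ dec Y j := by
  simp [dec, List.getElem?_append_right]

theorem getD_dec {w : List ℤ} {j : ℕ} (h : j < w.length) (l : ℕ) :
    (dec w j).getD l 0 = if l = j then w.getD l 0 - 1 else w.getD l 0 := by
  rcases eq_or_ne l j with rfl | hl
  · simp [dec, h]
  · simp [dec, hl, List.getElem?_set_ne (Ne.symm hl)]

theorem exists_eq_append_cons {w : List ℤ} {j : ℕ} (h : j < w.length) :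
    ∃ X a Y, w = X ++ a :: Y ∧ X.length = j :=
  ⟨w.take j, w[j], w.drop (j + 1), by simp, by simp; omega⟩

theorem eraseIdx_append_cons (X : List ℤ) (a : ℤ) (Y : List ℤ) :
    (X ++ a :: Y).eraseIdx X.length = X ++ Y := by
  simp [List.eraseIdx_append_of_length_le]

theorem eraseIdx_dec (w : List ℤ) (j : ℕ) : (dec w j).eraseIdx j = w.eraseIdx j := by
  simp [dec, List.eraseIdx_set_eq]

theorem sum_dec {w : List ℤ} {j : ℕ} (h : j < w.length) : (dec w j).sum = w.sum - 1 := by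
  obtain ⟨X, a, Y, rfl, rfl⟩ := exists_eq_append_cons h
  rw [dec_append_cons]
  simp
  ring

theorem getElem?_crossings_length (X : List ℤ) (a : ℤ) (Y : List ℤ) :
    (crossings (X ++ a :: Y))[X.length]? = some s(zperm X a, zperm X (a + 1)) := by
  rw [crossings_append_cons, List.getElem?_append_right (by simp)]
  simp

theorem exists_getElem?_crossings {w : List ℤ} {j : ℕ} (h : j < w.length) :
    ∃ p q, (crossings w)[j]? = some s(p, q) := by
  obtain ⟨X, a, Y, rfl, rfl⟩ := exists_eq_append_cons h
  exact ⟨_, _, getElem?_crossings_length X a Y⟩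

theorem zperm_eraseIdx {w : List ℤ} {j : ℕ} {p q : ℤ} (h : (crossings w)[j]? = some s(p, q)) :
    zperm (w.eraseIdx j) = Equiv.swap p q * zperm w := by
  obtain ⟨X, a, Y, rfl, rfl, h2⟩ := exists_split_of_getElem? h
  rw [eraseIdx_append_cons, zperm_erase_of_split h2]

/-- The passage from the crossings of a word to those of the word without its letter at index `j`
keeps the occurrences of the pair exchanged by that letter. -/
theorem getElem?_crossings_eraseIdx {w : List ℤ} {j i : ℕ} {p q : ℤ} (hij : i ≠ j)
    (hj : (crossings w)[j]? = some s(p, q)) :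
    (crossings w)[i]? = some s(p, q) ↔
      (crossings (w.eraseIdx j))[if i < j then i else i - 1]? = some s(p, q) := by
  obtain ⟨X, a, Y, rfl, rfl, h2⟩ := exists_split_of_getElem? hj
  rw [eraseIdx_append_cons, crossings_append_cons, crossings_append]
  split_ifs with hi
  · rw [List.getElem?_append_left (by simpa), List.getElem?_append_left (by simpa)]
  · obtain ⟨k, rfl⟩ : ∃ k, i = X.length + k + 1 := ⟨i - X.length - 1, by omega⟩
    rw [List.getElem?_append_right (by simp; omega), List.getElem?_append_right (by simp)]
    simp only [length_crossings, show X.length + k + 1 - X.length = k + 1 by omega,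
      show X.length + k + 1 - 1 - X.length = k by omega, List.getElem?_cons_succ,
      List.getElem?_map]
    rw [zperm_mul_zsimple, swap_eq_swap_of_mk_eq h2]
    cases (crossings Y)[k]? with
    | none => simp
    | some z =>
      have : Sym2.map (Equiv.swap p q * zperm X) z
          = Sym2.map (Equiv.swap p q) (Sym2.map (zperm X) z) := by
        rw [Sym2.map_map]; rfl
      simp only [Option.map_some, Option.some.injEq, this]
      conv_lhs => rw [← map_swap_mk p q]
      exact (map_injective _).eq_iff

theorem NearlyReduced.dec {w : List ℤ} {j : ℕ} (h : NearlyReduced w j) :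
    NearlyReduced (dec w j) j :=
  ⟨by simpa using h.1, by rw [eraseIdx_dec]; exact h.2⟩

theorem zperm_eraseIdx_eq {w : List ℤ} {j j' : ℕ} (hj : j < w.length)
    (hc : (crossings w)[j']? = (crossings w)[j]?) :
    zperm (w.eraseIdx j') = zperm (w.eraseIdx j) := by
  obtain ⟨p, q, h⟩ := exists_getElem?_crossings hj
  rw [zperm_eraseIdx h, zperm_eraseIdx (hc.trans h)]

theorem NearlyReduced.of_conflict {w : List ℤ} {j j' : ℕ} (h : NearlyReduced w j)
    (hlt : j' < w.length) (hc : (crossings w)[j']? = (crossings w)[j]?) : NearlyReduced w j' := by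
  refine ⟨hlt, h.2.of_zperm_eq (zperm_eraseIdx_eq h.1 hc) ?_⟩
  rw [List.length_eraseIdx_of_lt h.1, List.length_eraseIdx_of_lt hlt]

theorem not_zreduced_of_conflict {w : List ℤ} {j j' : ℕ} (h : j < w.length)
    (hlt : j' < w.length) (hne : j' ≠ j)
    (hc : (crossings w)[j']? = (crossings w)[j]?) : ¬ ZReduced w :=
  fun hw => hne (hw.index_unique hlt h hc)

theorem NearlyReduced.conflict_unique {w : List ℤ} {j i k : ℕ} (h : NearlyReduced w j)
    (hi : i < w.length) (hk : k < w.length) (hij : i ≠ j) (hkj : k ≠ j)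
    (hci : (crossings w)[i]? = (crossings w)[j]?)
    (hck : (crossings w)[k]? = (crossings w)[j]?) : i = k := by
  obtain ⟨p, q, hpq⟩ := exists_getElem?_crossings h.1
  rw [hpq] at hci hck
  rw [getElem?_crossings_eraseIdx hij hpq] at hci
  rw [getElem?_crossings_eraseIdx hkj hpq] at hck
  have hl := List.length_eraseIdx_of_lt h.1
  have hj := h.1
  have := h.2.index_unique (by rw [hl]; split_ifs <;> omega) (by rw [hl]; split_ifs <;> omega)
    (hci.trans hck.symm)
  split_ifs at this <;> omega

theorem NearlyReduced.exists_conflict {w : List ℤ} {j : ℕ} (h : NearlyReduced w j)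
    (hw : ¬ ZReduced w) :
    ∃ j' < w.length, j' ≠ j ∧ (crossings w)[j']? = (crossings w)[j]? := by
  obtain ⟨X, a, Y, rfl, rfl⟩ := exists_eq_append_cons h.1
  have hpq := getElem?_crossings_length X a Y
  have he := h.2
  rw [eraseIdx_append_cons] at he
  obtain ⟨k, hk⟩ := List.mem_iff_getElem?.1 (mem_crossings_of_not_zreduced he hw)
  have hkl := (List.getElem?_eq_some_iff.1 hk).1
  simp only [length_crossings, List.length_append] at hkl
  refine ⟨if k < X.length then k else k + 1, by simp; split_ifs <;> omega,
    by split_ifs <;> omega, ?_⟩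
  rw [hpq, getElem?_crossings_eraseIdx (by split_ifs <;> omega) hpq, eraseIdx_append_cons]
  convert hk using 2
  split_ifs <;> omega

theorem Settles.zreduced {n : ℕ} {y : List ℤ} {j : ℕ} {v : List ℤ} (h : Settles n y j v) :
    ZReduced v := by
  induction h with
  | done _ _ h => exact h
  | next _ _ _ _ _ _ _ _ _ _ ih => exact ih

theorem Settles.length_eq {n : ℕ} {y : List ℤ} {j : ℕ} {v : List ℤ} (h : Settles n y j v) :
    v.length = y.length := by
  induction h with
  | done => rfl
  | next _ _ _ _ _ _ _ _ _ _ ih => simpa using ih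

/-- The next letter to be lowered is determined by the word and the letter lowered last. -/
theorem Settles.next_of_conflict {n : ℕ} {y : List ℤ} {j j' : ℕ} {v : List ℤ}
    (h : Settles n y j v) (hy : NearlyReduced y j) (hlt : j' < y.length) (hne : j' ≠ j)
    (hc : (crossings y)[j']? = (crossings y)[j]?) :
    ∃ m < n, Settles m (Little.dec y j') j' v := by
  cases h with
  | done _ _ h => exact absurd h (not_zreduced_of_conflict hy.1 hlt hne hc)
  | next m _ _ k _ _ hlt' hne' hc' hv =>
    obtain rfl := hy.conflict_unique hlt hlt' hne hne' hc hc'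
    exact ⟨m, by omega, hv⟩

/-! ### Bumps terminate -/

theorem zperm_apply_of_lt {w : List ℤ} {m x : ℤ} (h : ∀ a ∈ w, m ≤ a) (hx : x < m) :
    zperm w x = x := by
  induction w with
  | nil => rfl
  | cons a t ih =>
    rw [zperm_cons, Equiv.Perm.mul_apply, ih (fun b hb => h b (by simp [hb])), zsimple_apply]
    have := h a (by simp)
    split_ifs <;> omega

theorem forall_crossings_le_iff {w : List ℤ} {m : ℤ} :
    (∀ z ∈ crossings w, ∀ p ∈ z, m ≤ p) ↔ ∀ a ∈ w, m ≤ a := by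
  induction w with
  | nil => simp
  | cons a t ih =>
    simp only [crossings_cons, List.forall_mem_cons, ← ih, List.forall_mem_map, Sym2.mem_iff,
      forall_eq_or_imp, forall_eq, Sym2.mem_map, forall_exists_index, and_imp,
      forall_apply_eq_imp_iff₂]
    refine ⟨fun ⟨⟨h1, _⟩, h2⟩ => ⟨h1, fun z hz p hp => ?_⟩,
      fun ⟨h1, h2⟩ => ⟨⟨h1, by omega⟩, fun z hz p hp => ?_⟩⟩
    · have := h2 z hz p hp
      rw [zsimple_apply] at this
      split_ifs at this <;> omega
    · have := h2 z hz p hp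
      rw [zsimple_apply]
      split_ifs <;> omega

theorem le_letters_of_zperm_eq {w u : List ℤ} {m : ℤ} (hw : ∀ a ∈ w, m ≤ a) (hu : ZReduced u)
    (h : zperm u = zperm w) : ∀ a ∈ u, m ≤ a := by
  rw [← forall_crossings_le_iff] at hw ⊢
  intro z hz
  induction z with | _ p q =>
  exact hw _ (mem_crossings_of_inverted (ne_of_mem_crossings hz) (h ▸ hu.inverted_of_mem hz))

theorem le_sum_of_forall_le {w : List ℤ} {m : ℤ} (h : ∀ a ∈ w, m ≤ a) :
    w.length * m ≤ w.sum := by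
  simpa using List.card_nsmul_le_sum w m h

/-- Throughout a bump, the word without the letter lowered last is a reduced word of one fixed
permutation, so its letters stay above a fixed bound `m`. A letter below `m` exchanges a pair of
values exchanged nowhere else, so no letter drops below `m - 1`, while their sum decreases. -/
theorem NearlyReduced.exists_settles {y : List ℤ} {j : ℕ} (hy : NearlyReduced y j) :
    ∃ n v, Settles n y j v := by
  obtain ⟨m, hm, hm'⟩ : ∃ m : ℤ, (∀ a ∈ y.eraseIdx j, m ≤ a) ∧ m - 1 ≤ y.getD j 0 := by
    have hb : ∃ m : ℤ, ∀ a ∈ y, m ≤ a := by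
      obtain ⟨m, hm⟩ := y.toFinset.bddBelow
      exact ⟨m, fun a ha => hm (by simpa using ha)⟩
    obtain ⟨m, hm⟩ := hb
    refine ⟨m, fun a ha => hm a (List.mem_of_mem_eraseIdx ha), ?_⟩
    have := hm (y.getD j 0) (by simp [hy.1])
    omega
  obtain ⟨N, hN⟩ : ∃ N : ℕ, y.sum < y.length * (m - 1) + N :=
    ⟨(y.sum - y.length * (m - 1)).toNat + 1, by push_cast; omega⟩
  induction N generalizing y j with
  | zero =>
    exfalso
    obtain ⟨X, a, Y, rfl, rfl⟩ := exists_eq_append_cons hy.1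
    rw [eraseIdx_append_cons] at hm
    have := le_sum_of_forall_le (w := X ++ a :: Y) (m := m - 1) (by
      intro b hb
      simp only [List.mem_append, List.mem_cons] at hb
      rcases hb with hb | rfl | hb
      · have := hm b (by simp [hb]); omega
      · simpa using hm'
      · have := hm b (by simp [hb]); omega)
    push_cast at hN
    omega
  | succ N ih =>
    by_cases hr : ZReduced y
    · exact ⟨0, y, .done y j hr⟩
    obtain ⟨j', hlt, hne, hc⟩ := hy.exists_conflict hr
    have hy' := hy.of_conflict hlt hc
    have hle : m ≤ y.getD j' 0 := by
      refine hm _ ?_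
      rw [List.mem_eraseIdx_iff_getElem?]
      exact ⟨j', hne, by simp [hlt]⟩
    obtain ⟨n, v, hv⟩ := @ih (Little.dec y j') j' hy'.dec
      (by
        rw [eraseIdx_dec]
        exact le_letters_of_zperm_eq hm hy'.2 (zperm_eraseIdx_eq hy.1 hc))
      (by rw [getD_dec hlt, if_pos rfl]; omega)
      (by rw [sum_dec hlt, length_dec]; push_cast at hN; omega)
    exact ⟨n + 1, v, .next n y j j' v hr hlt hne hc hv⟩

/-! ### Bumps preserve the descents of a word -/

theorem crossings_eq_of_adjacent_eq {w : List ℤ} {l : ℕ} (hl : l + 1 < w.length)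
    (h : w.getD l 0 = w.getD (l + 1) 0) : (crossings w)[l]? = (crossings w)[l + 1]? := by
  obtain ⟨X, a, Y, rfl, rfl⟩ := exists_eq_append_cons (by omega : l < w.length)
  cases Y with
  | nil => simp at hl
  | cons b Z =>
    obtain rfl : a = b := by simpa [List.getElem?_append_right] using h
    rw [getElem?_crossings_length, show X ++ a :: a :: Z = (X ++ [a]) ++ a :: Z by simp,
      show X.length + 1 = (X ++ [a]).length by simp, getElem?_crossings_length]
    simp [zsimple_apply, Sym2.eq_swap]

/-- If a bump makes two adjacent letters equal, then it lowers the other one of them next; so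
their order never changes. -/
theorem Settles.lt_iff {n : ℕ} {y : List ℤ} {j : ℕ} {v : List ℤ} (h : Settles n y j v)
    (hy : NearlyReduced y j) {l : ℕ} (hl : l + 1 < y.length) :
    ((y.getD l 0 < y.getD (l + 1) 0 ∨ y.getD l 0 = y.getD (l + 1) 0 ∧ j = l + 1) →
        v.getD l 0 < v.getD (l + 1) 0) ∧
      ((y.getD (l + 1) 0 < y.getD l 0 ∨ y.getD l 0 = y.getD (l + 1) 0 ∧ j = l) →
        v.getD (l + 1) 0 < v.getD l 0) := by
  induction h with
  | done y j h =>
    have : y.getD l 0 ≠ y.getD (l + 1) 0 := fun he => by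
      have := h.index_unique (by omega) hl (crossings_eq_of_adjacent_eq hl he)
      omega
    omega
  | next n y j j' v h hlt hne hc hv ih =>
    have hy' := hy.of_conflict hlt hc
    have ih := ih hy'.dec (by simpa using hl)
    have key : y.getD l 0 = y.getD (l + 1) 0 → (j = l → j' = l + 1) ∧ (j = l + 1 → j' = l) := by
      intro he
      have hce := crossings_eq_of_adjacent_eq hl he
      refine ⟨?_, ?_⟩
      · rintro rfl
        exact hy.conflict_unique hlt hl hne (by omega) hc hce.symm
      · rintro rfl
        exact hy.conflict_unique hlt (by omega) hne (by omega) hc hce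
    rw [getD_dec hlt, getD_dec hlt] at ih
    split_ifs at ih <;> omega

theorem ZBump.lt_iff {w v : List ℤ} (h : ZBump w v) {l : ℕ} (hl : l + 1 < w.length) :
    (w.getD l 0 < w.getD (l + 1) 0 ↔ v.getD l 0 < v.getD (l + 1) 0) ∧
      (w.getD (l + 1) 0 < w.getD l 0 ↔ v.getD (l + 1) 0 < v.getD l 0) := by
  obtain ⟨hw, i, n, hi, hs⟩ := h
  have hne : w.getD l 0 ≠ w.getD (l + 1) 0 := fun he => by
    have := hw.index_unique (by omega) hl (crossings_eq_of_adjacent_eq hl he)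
    omega
  have := hs.lt_iff hi.dec (l := l) (by simpa using hl)
  rw [getD_dec hi.1, getD_dec hi.1] at this
  split_ifs at this <;> omega

theorem ZBump.length_eq {w v : List ℤ} (h : ZBump w v) : v.length = w.length := by
  obtain ⟨hw, i, n, hi, hs⟩ := h
  simpa using hs.length_eq

theorem ZBump.zreduced {w v : List ℤ} (h : ZBump w v) : ZReduced v := by
  obtain ⟨hw, i, n, hi, hs⟩ := h
  exact hs.zreduced

/-! ### Coxeter–Knuth moves commute with bumps -/

/-- The Coxeter–Knuth relations on words of three letters. The permutation of the indices
`0, 1, 2` matches the letters which exchange the same pair of values. -/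
inductive CKRule : List ℤ → List ℤ → Equiv.Perm ℕ → Prop
  | left (x y z : ℤ) (hxy : x < y) (hyz : y < z) : CKRule [x, z, y] [z, x, y] (Equiv.swap 0 1)
  | right (x y z : ℤ) (hxy : x < y) (hyz : y < z) : CKRule [y, x, z] [y, z, x] (Equiv.swap 1 2)
  | braid (a : ℤ) : CKRule [a, a + 1, a] [a + 1, a, a + 1] (Equiv.swap 0 2)

/-- The symmetric closure of the Coxeter–Knuth relations. -/
def CK (t u : List ℤ) (π : Equiv.Perm ℕ) : Prop := CKRule t u π ∨ CKRule u t π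

/-- `LocalRun t x t' x'`: a bump inside a word of few letters, which has just lowered the letter
at `x` and thereby reached `t`, reaches `t'` by lowering the letter at `x'`. -/
inductive LocalRun : List ℤ → ℕ → List ℤ → ℕ → Prop
  | refl (t : List ℤ) (x : ℕ) : LocalRun t x t x
  | step (t : List ℤ) (x x₁ : ℕ) (t' : List ℤ) (x' : ℕ) (hlt : x₁ < t.length) (hne : x₁ ≠ x)
      (hc : (crossings t)[x₁]? = (crossings t)[x]?) (h : LocalRun (dec t x₁) x₁ t' x') :
      LocalRun t x t' x'

/-- Bumps inside two words of three letters reach words related by a Coxeter–Knuth relation, by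
lowering letters which exchange the same pair of values. -/
def LocalMatch (t : List ℤ) (x : ℕ) (u : List ℤ) (y : ℕ) : Prop :=
  ∃ t' u' π x', x' < 3 ∧ CK t' u' π ∧ LocalRun t x t' x' ∧ LocalRun u y u' (π x')

theorem CK.symm {t u : List ℤ} {π : Equiv.Perm ℕ} (h : CK t u π) : CK u t π := Or.symm h

theorem zsimple_of_eq {a x : ℤ} (h : x = a) : zsimple a x = a + 1 := by
  rw [zsimple_apply, if_pos h]

theorem zsimple_of_eq_succ {a x : ℤ} (h : x = a + 1) : zsimple a x = a := by
  rw [zsimple_apply, if_neg (by omega), if_pos h]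

theorem zsimple_of_lt {a x : ℤ} (h : x < a) : zsimple a x = x := by
  rw [zsimple_apply, if_neg (by omega), if_neg (by omega)]

theorem zsimple_of_gt {a x : ℤ} (h : a + 1 < x) : zsimple a x = x := by
  rw [zsimple_apply, if_neg (by omega), if_neg (by omega)]

theorem crossings_three (p q r : ℤ) : crossings [p, q, r] =
    [s(p, p + 1), s(zsimple p q, zsimple p (q + 1)),
      s(zsimple p (zsimple q r), zsimple p (zsimple q (r + 1)))] := by
  simp

theorem CKRule.zreduced {t u : List ℤ} {π : Equiv.Perm ℕ} (h : CKRule t u π) : ZReduced t := by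
  rw [ZReduced]
  cases h with
  | left x y z hxy hyz =>
    rw [crossings_three]
    rcases (by omega : y = x + 1 ∨ x + 1 < y) with h1 | h1 <;>
    rcases (by omega : z = y + 1 ∨ y + 1 < z) with h2 | h2 <;>
    simp (disch := omega) only [zsimple_of_eq, zsimple_of_eq_succ, zsimple_of_lt,
      zsimple_of_gt] <;> simp <;> omega
  | right x y z hxy hyz =>
    rw [crossings_three]
    rcases (by omega : y = x + 1 ∨ x + 1 < y) with h1 | h1 <;>
    rcases (by omega : z = y + 1 ∨ y + 1 < z) with h2 | h2 <;>
    simp (disch := omega) only [zsimple_of_eq, zsimple_of_eq_succ, zsimple_of_lt,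
      zsimple_of_gt] <;> simp <;> omega
  | braid a =>
    rw [crossings_three]
    simp (disch := omega) only [zsimple_of_eq, zsimple_of_eq_succ, zsimple_of_lt,
      zsimple_of_gt]
    simp
    omega

theorem CKRule.crossings_eq {t u : List ℤ} {π : Equiv.Perm ℕ} (h : CKRule t u π) {i : ℕ}
    (hi : i < 3) : (crossings t)[i]? = (crossings u)[π i]? := by
  cases h with
  | left x y z hxy hyz =>
    rw [crossings_three, crossings_three]
    rcases (by omega : y = x + 1 ∨ x + 1 < y) with h1 | h1 <;>
    rcases (by omega : z = y + 1 ∨ y + 1 < z) with h2 | h2 <;>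
    simp (disch := omega) only [zsimple_of_eq, zsimple_of_eq_succ, zsimple_of_lt,
      zsimple_of_gt] <;>
    interval_cases i <;> simp [Equiv.swap_apply_def]
  | right x y z hxy hyz =>
    rw [crossings_three, crossings_three]
    rcases (by omega : y = x + 1 ∨ x + 1 < y) with h1 | h1 <;>
    rcases (by omega : z = y + 1 ∨ y + 1 < z) with h2 | h2 <;>
    simp (disch := omega) only [zsimple_of_eq, zsimple_of_eq_succ, zsimple_of_lt,
      zsimple_of_gt] <;>
    interval_cases i <;> simp [Equiv.swap_apply_def]
  | braid a =>
    rw [crossings_three, crossings_three]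
    simp (disch := omega) only [zsimple_of_eq, zsimple_of_eq_succ, zsimple_of_lt,
      zsimple_of_gt]
    interval_cases i <;> simp [Equiv.swap_apply_def]

theorem zsimple_mul_comm {a b : ℤ} (h : a + 1 < b) :
    zsimple a * zsimple b = zsimple b * zsimple a := by
  ext v
  simp only [Equiv.Perm.mul_apply, zsimple_apply]
  split_ifs <;> omega

theorem zsimple_braid (a : ℤ) : zsimple a * (zsimple (a + 1) * zsimple a) =
    zsimple (a + 1) * (zsimple a * zsimple (a + 1)) := by
  ext v
  simp only [Equiv.Perm.mul_apply]
  rcases (by omega : v < a ∨ v = a ∨ v = a + 1 ∨ v = a + 2 ∨ a + 2 < v) with h | h | h | h | h <;>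
  simp (disch := omega) only [zsimple_of_eq, zsimple_of_eq_succ, zsimple_of_lt,
      zsimple_of_gt]

theorem CKRule.zperm_eq {t u : List ℤ} {π : Equiv.Perm ℕ} (h : CKRule t u π) :
    zperm t = zperm u := by
  cases h with
  | left x y z hxy hyz =>
    simp only [zperm_cons, ← mul_assoc]
    rw [zsimple_mul_comm (by omega : x + 1 < z)]
  | right x y z hxy hyz =>
    simp only [zperm_cons, zperm_nil, mul_one]
    rw [zsimple_mul_comm (by omega : x + 1 < z)]
  | braid a => simpa using zsimple_braid a

theorem CK.zperm_eq {t u : List ℤ} {π : Equiv.Perm ℕ} (h : CK t u π) : zperm t = zperm u :=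
  h.elim CKRule.zperm_eq fun h => h.zperm_eq.symm

theorem CK.length_left {t u : List ℤ} {π : Equiv.Perm ℕ} (h : CK t u π) : t.length = 3 := by
  rcases h with h | h <;> cases h <;> rfl

theorem CK.length_right {t u : List ℤ} {π : Equiv.Perm ℕ} (h : CK t u π) : u.length = 3 :=
  h.symm.length_left

theorem CK.zreduced {t u : List ℤ} {π : Equiv.Perm ℕ} (h : CK t u π) : ZReduced t := by
  rcases id h with h' | h'
  · exact h'.zreduced
  · exact h'.zreduced.of_zperm_eq h.zperm_eq (h.length_left.trans h.length_right.symm)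

theorem CK.involutive {t u : List ℤ} {π : Equiv.Perm ℕ} (h : CK t u π) (i : ℕ) :
    π (π i) = i := by
  rcases h with h | h <;> cases h <;> simp

theorem CK.lt_three {t u : List ℤ} {π : Equiv.Perm ℕ} (h : CK t u π) {i : ℕ} (hi : i < 3) :
    π i < 3 := by
  rcases h with h | h <;> cases h <;> interval_cases i <;> simp [Equiv.swap_apply_def]

theorem CK.crossings_eq {t u : List ℤ} {π : Equiv.Perm ℕ} (h : CK t u π) {i : ℕ}
    (hi : i < 3) : (crossings t)[i]? = (crossings u)[π i]? := by
  rcases id h with h' | h'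
  · exact h'.crossings_eq hi
  · rw [h'.crossings_eq (h.lt_three hi), h.involutive]

theorem LocalRun.single {t : List ℤ} {x x₁ : ℕ} (hlt : x₁ < t.length) (hne : x₁ ≠ x)
    (hc : (crossings t)[x₁]? = (crossings t)[x]?) : LocalRun t x (dec t x₁) x₁ :=
  .step t x x₁ _ _ hlt hne hc (.refl _ _)

theorem LocalMatch.symm {t u : List ℤ} {x y : ℕ} (h : LocalMatch t x u y) :
    LocalMatch u y t x := by
  obtain ⟨t', u', π, x', hx', hck, h1, h2⟩ := h
  exact ⟨u', t', π, π x', hck.lt_three hx', hck.symm, h2, by rwa [hck.involutive]⟩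

theorem crossings_three_01 (p r : ℤ) : (crossings [p, p, r])[1]? = (crossings [p, p, r])[0]? :=
  (crossings_eq_of_adjacent_eq (w := [p, p, r]) (l := 0) (by simp) (by simp)).symm

theorem crossings_three_12 (p r : ℤ) : (crossings [p, r, r])[2]? = (crossings [p, r, r])[1]? :=
  (crossings_eq_of_adjacent_eq (w := [p, r, r]) (l := 1) (by simp) (by simp)).symm

theorem crossings_three_02 {p q : ℤ} (h : p + 1 < q ∨ q + 1 < p) :
    (crossings [p, q, p])[2]? = (crossings [p, q, p])[0]? := by
  rw [crossings_three]
  rcases h with h | h <;> simp (disch := omega) only [zsimple_of_lt, zsimple_of_gt] <;>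
    simp [zsimple_apply, Sym2.eq_swap]

/-- The bumps inside two words related by a Coxeter–Knuth relation, started at letters which
exchange the same pair of values. -/
theorem CKRule.localMatch {t u : List ℤ} {π : Equiv.Perm ℕ} (h : CKRule t u π) {i : ℕ}
    (hi : i < 3) (he : ZReduced (t.eraseIdx i)) :
    LocalMatch (dec t i) i (dec u (π i)) (π i) := by
  cases h with
  | left x y z hxy hyz =>
    interval_cases i
    · exact ⟨[x - 1, z, y], [z, x - 1, y], _, 0, by simp, Or.inl (.left _ _ _ (by omega) hyz),
        .refl _ _, .refl _ _⟩
    · rcases (by omega : z = y + 1 ∨ y < z - 1) with rfl | hz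
      · have ht : LocalRun [x, y, y] 1 [x, y, y - 1] 2 :=
          .single (by simp) (by simp) (crossings_three_12 x y)
        rcases (by omega : y = x + 1 ∨ x < y - 1) with rfl | hy
        · exact ⟨_, [x + 1, x, x + 1], Equiv.swap 0 2, 2, by simp,
            Or.inl (by simpa using CKRule.braid x), by simpa [dec] using ht,
            by simpa [dec] using LocalRun.refl [x + 1, x, x + 1] 0⟩
        · have hu : LocalRun [y, x, y] 0 [y, x, y - 1] 2 :=
            .single (by simp) (by simp) (crossings_three_02 (by omega))
          exact ⟨_, [y, x, y - 1], _, 2, by simp, Or.inl (.left x (y - 1) y hy (by omega)),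
            by simpa [dec] using ht, by simpa [dec, Equiv.swap_apply_def] using hu⟩
      · exact ⟨[x, z - 1, y], [z - 1, x, y], _, 1, by simp, Or.inl (.left _ _ _ hxy hz),
          .refl _ _, .refl _ _⟩
    · rcases (by omega : y = x + 1 ∨ x < y - 1) with rfl | hy
      · have ht : LocalRun [x, z, x] 2 [x - 1, z, x] 0 :=
          .single (by simp) (by simp) (crossings_three_02 (by omega)).symm
        have hu : LocalRun [z, x, x] 2 [z, x - 1, x] 1 :=
          .single (by simp) (by simp) (crossings_three_12 _ _).symm
        exact ⟨_, [z, x - 1, x], _, 0, by simp, Or.inl (.left (x - 1) x z (by omega) (by omega)),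
            by simpa [dec] using ht, by simpa [dec, Equiv.swap_apply_def] using hu⟩
      · exact ⟨[x, z, y - 1], [z, x, y - 1], _, 2, by simp, Or.inl (.left _ _ _ hy (by omega)),
          .refl _ _, .refl _ _⟩
  | right x y z hxy hyz =>
    interval_cases i
    · rcases (by omega : y = x + 1 ∨ x < y - 1) with rfl | hy
      · have ht : LocalRun [x, x, z] 0 [x, x - 1, z] 1 :=
          .single (by simp) (by simp) (crossings_three_01 _ _)
        have hu : LocalRun [x, z, x] 0 [x, z, x - 1] 2 :=
          .single (by simp) (by simp) (crossings_three_02 (by omega))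
        exact ⟨_, [x, z, x - 1], _, 1, by simp, Or.inl (.right (x - 1) x z (by omega) (by omega)),
            by simpa [dec] using ht, by simpa [dec, Equiv.swap_apply_def] using hu⟩
      · exact ⟨[y - 1, x, z], [y - 1, z, x], _, 0, by simp, Or.inl (.right _ _ _ hy (by omega)),
          .refl _ _, .refl _ _⟩
    · exact ⟨[y, x - 1, z], [y, z, x - 1], _, 1, by simp, Or.inl (.right _ _ _ (by omega) hyz),
        .refl _ _, .refl _ _⟩
    · rcases (by omega : z = y + 1 ∨ y < z - 1) with rfl | hz
      · have hu : LocalRun [y, y, x] 1 [y - 1, y, x] 0 :=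
          .single (by simp) (by simp) (crossings_three_01 _ _).symm
        rcases (by omega : y = x + 1 ∨ x < y - 1) with rfl | hy
        · refine ⟨[x + 1, x, x + 1], [x, x + 1, x], _, 2, by simp, Or.inr (.braid x),
            by simpa [dec] using LocalRun.refl _ _,
            by simpa [dec, Equiv.swap_apply_def] using hu⟩
        · have ht : LocalRun [y, x, y] 2 [y - 1, x, y] 0 :=
            .single (by simp) (by simp) (crossings_three_02 (by omega)).symm
          exact ⟨_, [y - 1, y, x], _, 0, by simp, Or.inl (.right x (y - 1) y hy (by omega)),
            by simpa [dec] using ht, by simpa [dec, Equiv.swap_apply_def] using hu⟩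
      · exact ⟨[y, x, z - 1], [y, z - 1, x], _, 2, by simp, Or.inl (.right _ _ _ hxy hz),
          .refl _ _, .refl _ _⟩
  | braid a =>
    interval_cases i
    · have hu : LocalRun [a + 1, a, a] 2 [a + 1, a - 1, a] 1 :=
        .single (by simp) (by simp) (crossings_three_12 _ _).symm
      exact ⟨[a - 1, a + 1, a], [a + 1, a - 1, a], _, 0, by simp,
        Or.inl (.left (a - 1) a (a + 1) (by omega) (by omega)),
        .refl _ _, by simpa [dec, Equiv.swap_apply_def] using hu⟩
    · exfalso
      simp [ZReduced, zsimple_apply, Sym2.eq_swap] at he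
    · have hu : LocalRun [a, a, a + 1] 0 [a, a - 1, a + 1] 1 :=
        .single (by simp) (by simp) (crossings_three_01 _ _)
      exact ⟨[a, a + 1, a - 1], [a, a - 1, a + 1], _, 2, by simp,
        Or.inr (.right (a - 1) a (a + 1) (by omega) (by omega)),
        .refl _ _, by simpa [dec, Equiv.swap_apply_def] using hu⟩

theorem CK.localMatch {t u : List ℤ} {π : Equiv.Perm ℕ} (h : CK t u π) {i : ℕ}
    (hi : i < 3) (he : ZReduced (t.eraseIdx i)) :
    LocalMatch (dec t i) i (dec u (π i)) (π i) := by
  rcases id h with h' | h'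
  · exact h'.localMatch hi he
  · have hl := h.length_left
    have hr := h.length_right
    have hi' := h.lt_three hi
    have hc := h.crossings_eq hi
    obtain ⟨p, q, hpq⟩ := exists_getElem?_crossings (w := t) (j := i) (by omega)
    have := h'.localMatch hi' (he.of_zperm_eq
      (by rw [zperm_eraseIdx (hc ▸ hpq), zperm_eraseIdx hpq, h.zperm_eq])
      (by rw [List.length_eraseIdx_of_lt (by omega), List.length_eraseIdx_of_lt (by omega)]
          omega))
    rw [h.involutive] at this
    exact this.symm

theorem LocalRun.length_eq {t : List ℤ} {x : ℕ} {t' : List ℤ} {x' : ℕ}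
    (h : LocalRun t x t' x') : t'.length = t.length := by
  induction h with
  | refl => rfl
  | step _ _ _ _ _ _ _ _ _ ih => simpa using ih

/-! ### Bumps of a word and of a factor -/

theorem getElem?_crossings_mid (A t B : List ℤ) {x : ℕ} (hx : x < t.length) :
    (crossings (A ++ t ++ B))[A.length + x]? =
      (crossings t)[x]?.map (Sym2.map (zperm A)) := by
  rw [List.append_assoc, crossings_append, List.getElem?_append_right (by simp),
    crossings_append]
  simp [List.getElem?_append_left, hx]

theorem getElem?_crossings_mid_inj (A t B : List ℤ) {x y : ℕ} (hx : x < t.length)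
    (hy : y < t.length) :
    (crossings (A ++ t ++ B))[A.length + x]? = (crossings (A ++ t ++ B))[A.length + y]? ↔
      (crossings t)[x]? = (crossings t)[y]? := by
  rw [getElem?_crossings_mid _ _ _ hx, getElem?_crossings_mid _ _ _ hy]
  exact (Option.map_injective (map_injective _)).eq_iff

theorem dec_mid (A t B : List ℤ) {x : ℕ} (hx : x < t.length) :
    dec (A ++ t ++ B) (A.length + x) = A ++ dec t x ++ B := by
  rw [List.append_assoc, dec_append_right, dec_append_left hx, List.append_assoc]

theorem LocalRun.settles_of {t : List ℤ} {x : ℕ} {t' : List ℤ} {x' : ℕ}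
    (h : LocalRun t x t' x') (hx : x < t.length) (A B : List ℤ) {n : ℕ} {v : List ℤ}
    (hs : Settles n (A ++ t ++ B) (A.length + x) v)
    (hn : NearlyReduced (A ++ t ++ B) (A.length + x)) :
    NearlyReduced (A ++ t' ++ B) (A.length + x') ∧
      ∃ m ≤ n, Settles m (A ++ t' ++ B) (A.length + x') v := by
  induction h generalizing n with
  | refl => exact ⟨hn, n, le_rfl, hs⟩
  | step t x x₁ t' x' hlt hne hc h ih =>
    have hc' := (getElem?_crossings_mid_inj A t B hlt hx).2 hc
    have hlt' : A.length + x₁ < (A ++ t ++ B).length := by simp; omega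
    obtain ⟨m, hm, hs'⟩ := hs.next_of_conflict hn hlt' (by omega) hc'
    have hn' := (hn.of_conflict hlt' hc').dec
    rw [dec_mid _ _ _ hlt] at hs' hn'
    obtain ⟨h1, k, hk, h2⟩ := ih (by simpa) hs' hn'
    exact ⟨h1, k, by omega, h2⟩

theorem LocalRun.settles {t : List ℤ} {x : ℕ} {t' : List ℤ} {x' : ℕ}
    (h : LocalRun t x t' x') (hx : x < t.length) (A B : List ℤ) {n : ℕ} {v : List ℤ}
    (hs : Settles n (A ++ t' ++ B) (A.length + x') v) :
    ∃ m, Settles m (A ++ t ++ B) (A.length + x) v := by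
  induction h with
  | refl => exact ⟨n, hs⟩
  | step t x x₁ t' x' hlt hne hc h ih =>
    obtain ⟨m, hm⟩ := ih (by simpa) hs
    have hc' := (getElem?_crossings_mid_inj A t B hlt hx).2 hc
    have hlt' : A.length + x₁ < (A ++ t ++ B).length := by simp; omega
    rw [← dec_mid _ _ _ hlt] at hm
    exact ⟨m + 1, .next m _ _ _ v
      (not_zreduced_of_conflict (by simp; omega) hlt' (by omega) hc') hlt' (by omega) hc' hm⟩

/-! ### Simulating a bump after a Coxeter–Knuth move -/

/-- The indices `j` and `k` match in words which differ, by a Coxeter–Knuth relation with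
matching `π`, in the three letters at the indices `L, L + 1, L + 2`. -/
def Matching (L : ℕ) (π : Equiv.Perm ℕ) (j k : ℕ) : Prop :=
  ((j < L ∨ L + 3 ≤ j) ∧ k = j) ∨ ∃ x < 3, j = L + x ∧ k = L + π x

theorem CK.zperm_mid {t u : List ℤ} {π : Equiv.Perm ℕ} (h : CK t u π) (A B : List ℤ) :
    zperm (A ++ u ++ B) = zperm (A ++ t ++ B) := by
  simp [h.zperm_eq]

theorem CK.length_mid {t u : List ℤ} {π : Equiv.Perm ℕ} (h : CK t u π) (A B : List ℤ) :
    (A ++ u ++ B).length = (A ++ t ++ B).length := by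
  simp [h.length_left, h.length_right]

theorem CK.zreduced_mid {t u : List ℤ} {π : Equiv.Perm ℕ} (h : CK t u π) {A B : List ℤ}
    (hr : ZReduced (A ++ t ++ B)) : ZReduced (A ++ u ++ B) :=
  hr.of_zperm_eq (h.zperm_mid A B) (h.length_mid A B)

theorem CK.crossings_mid {t u : List ℤ} {π : Equiv.Perm ℕ} (h : CK t u π) (A B : List ℤ)
    {j k : ℕ} (hjk : Matching A.length π j k) :
    (crossings (A ++ u ++ B))[k]? = (crossings (A ++ t ++ B))[j]? := by
  have hl := h.length_left
  have hr := h.length_right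
  rcases hjk with ⟨hj | hj, rfl⟩ | ⟨x, hx, rfl, rfl⟩
  · rw [List.append_assoc, List.append_assoc, crossings_append, crossings_append A,
      List.getElem?_append_left (by simpa), List.getElem?_append_left (by simpa)]
  · rw [crossings_append, crossings_append _ B,
      List.getElem?_append_right (by simp; omega), List.getElem?_append_right (by simp; omega)]
    simp [h.zperm_eq, hl, hr]
  · have := h.lt_three hx
    rw [getElem?_crossings_mid _ _ _ (by omega), getElem?_crossings_mid _ _ _ (by omega),
      h.crossings_eq hx]

/-- A bump which has just lowered the letter at index `k` and thereby reached `y` ends in a word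
which differs from `v` by a Coxeter–Knuth relation in the three letters from index `L` on. -/
def SettlesRelated (L : ℕ) (v y : List ℤ) (k : ℕ) : Prop :=
  ∃ A t u B π m, CK t u π ∧ A.length = L ∧ v = A ++ t ++ B ∧ Settles m y k (A ++ u ++ B)

/-- `SimulatesUpTo N`: bumps lowering at most `N` further letters can be carried out in parallel
in two words which differ by a Coxeter–Knuth relation. -/
def SimulatesUpTo (N : ℕ) : Prop :=
  ∀ n ≤ N, ∀ (A t u B : List ℤ) (π : Equiv.Perm ℕ) (j k : ℕ) (v : List ℤ), CK t u π →
    Matching A.length π j k → NearlyReduced (A ++ t ++ B) j →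
    Settles n (A ++ t ++ B) j v → SettlesRelated A.length v (A ++ u ++ B) k

theorem ZReduced.eraseIdx_factor {A t B : List ℤ} {x : ℕ} (hx : x < t.length)
    (h : ZReduced ((A ++ t ++ B).eraseIdx (A.length + x))) : ZReduced (t.eraseIdx x) := by
  rw [List.append_assoc, List.eraseIdx_append_of_length_le (by omega),
    Nat.add_sub_cancel_left, List.eraseIdx_append_of_lt_length hx] at h
  exact h.of_append_right.of_append_left

theorem CK.settlesRelated_dec {N : ℕ} (hN : SimulatesUpTo N) {A t u B : List ℤ}
    {π : Equiv.Perm ℕ} (h : CK t u π) {j k : ℕ} (hjk : Matching A.length π j k) {v : List ℤ}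
    (hn : NearlyReduced (A ++ t ++ B) j) (hs : Settles N (dec (A ++ t ++ B) j) j v) :
    SettlesRelated A.length v (dec (A ++ u ++ B) k) k := by
  have hl := h.length_left
  have hr := h.length_right
  have hd := hn.dec
  rcases id hjk with ⟨hj | hj, rfl⟩ | ⟨x, hx, rfl, rfl⟩
  · rw [List.append_assoc, dec_append_left hj, ← List.append_assoc] at hs hd ⊢
    have := hN N le_rfl (dec A k) t u B π k k v h (by simpa using hjk) hd hs
    simpa using this
  · obtain ⟨i, rfl⟩ : ∃ i, k = A.length + 3 + i := ⟨k - (A.length + 3), by omega⟩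
    rw [show A.length + 3 + i = (A ++ t).length + i by simp [hl], dec_append_right] at hs hd
    rw [show A.length + 3 + i = (A ++ u).length + i by simp [hr], dec_append_right]
    exact hN N le_rfl A t u (dec B i) π _ _ v h (by simpa [hl, hr] using hjk) hd hs
  · have hx' := h.lt_three hx
    rw [dec_mid _ _ _ (by omega)] at hs hd ⊢
    have he := hn.2.eraseIdx_factor (by omega)
    obtain ⟨t', u', π', x', hx3, hck, h1, h2⟩ := h.localMatch hx he
    obtain ⟨hn', m, hm, hs'⟩ := h1.settles_of (by simp; omega) A B hs hd
    obtain ⟨A', s, s', B', ρ, m', hck', hA, hv, hs2⟩ := hN m hm A t' u' B π' _ _ v hck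
      (Or.inr ⟨x', hx3, rfl, rfl⟩) hn' hs'
    obtain ⟨m2, hm2⟩ := h2.settles (by simp; omega) A B hs2
    exact ⟨A', s, s', B', ρ, m2, hck', hA, hv, hm2⟩

theorem simulatesUpTo (N : ℕ) : SimulatesUpTo N := by
  induction N using Nat.strong_induction_on with
  | _ N ih =>
  intro n hnN A t u B π j k v h hjk hn hs
  have hl := h.length_left
  have hr := h.length_right
  cases hs with
  | done _ _ hr => exact ⟨A, t, u, B, π, 0, h, rfl, rfl, .done _ _ (h.zreduced_mid hr)⟩
  | next n _ _ j' _ hnr hlt hne hc hv =>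
    obtain ⟨k', hk', hne'⟩ : ∃ k', Matching A.length π j' k' ∧ k' ≠ k := by
      by_cases hj' : j' < A.length ∨ A.length + 3 ≤ j'
      · refine ⟨j', Or.inl ⟨hj', rfl⟩, ?_⟩
        rcases hjk with ⟨hj, rfl⟩ | ⟨x, hx, rfl, rfl⟩
        · exact hne
        · have := h.lt_three hx
          omega
      · obtain ⟨x, rfl⟩ : ∃ x, j' = A.length + x := ⟨j' - A.length, by omega⟩
        refine ⟨_, Or.inr ⟨x, by omega, rfl, rfl⟩, ?_⟩
        have := h.lt_three (i := x) (by omega)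
        rcases hjk with ⟨hj, rfl⟩ | ⟨y, hy, rfl, rfl⟩
        · omega
        · rw [getElem?_crossings_mid_inj _ _ _ (by omega) (by omega)] at hc
          exact absurd (h.zreduced.index_unique (by omega) (by omega) hc) (by omega)
    have hlt' : k' < (A ++ u ++ B).length := by
      rw [h.length_mid]
      rcases hk' with ⟨_, rfl⟩ | ⟨x, hx, rfl, rfl⟩
      · exact hlt
      · have := h.lt_three hx
        simp; omega
    obtain ⟨A', s, s', B', ρ, m, h1, h2, h3, h4⟩ := h.settlesRelated_dec (ih n (by omega)) hk'
      (hn.of_conflict hlt hc) hv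
    refine ⟨A', s, s', B', ρ, m + 1, h1, h2, h3, .next m _ _ k' _ ?_ hlt' hne' ?_ h4⟩
    · exact fun hr => hnr (h.symm.zreduced_mid hr)
    · rw [h.crossings_mid A B hk', h.crossings_mid A B hjk, hc]

theorem ZBump.exists_related {A t u B v : List ℤ} {π : Equiv.Perm ℕ} (h : CK t u π)
    (hb : ZBump (A ++ t ++ B) v) :
    ∃ A' t' u' B' ρ, CK t' u' ρ ∧ A'.length = A.length ∧ v = A' ++ t' ++ B' ∧
      ZBump (A ++ u ++ B) (A' ++ u' ++ B') := by
  obtain ⟨hr, i, n, hi, hs⟩ := hb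
  have hlr := h.length_right
  have hll := h.length_left
  obtain ⟨k, hik⟩ : ∃ k, Matching A.length π i k := by
    by_cases hj' : i < A.length ∨ A.length + 3 ≤ i
    · exact ⟨i, Or.inl ⟨hj', rfl⟩⟩
    · exact ⟨_, Or.inr ⟨i - A.length, by omega, by omega, rfl⟩⟩
  have hk : k < (A ++ u ++ B).length := by
    rw [h.length_mid]
    rcases hik with ⟨_, rfl⟩ | ⟨x, hx, rfl, rfl⟩
    · exact hi.1
    · have := h.lt_three hx
      simp; omega
  obtain ⟨A', t', u', B', ρ, m, h1, h2, h3, h4⟩ :=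
    h.settlesRelated_dec (simulatesUpTo n) hik hi hs
  refine ⟨A', t', u', B', ρ, h1, h2, h3, h.zreduced_mid hr, k, m, ⟨hk, ?_⟩, h4⟩
  obtain ⟨p, q, hpq⟩ := exists_getElem?_crossings hi.1
  refine hi.2.of_zperm_eq ?_ ?_
  · rw [zperm_eraseIdx hpq, zperm_eraseIdx ((h.crossings_mid A B hik).trans hpq), h.zperm_mid]
  · rw [List.length_eraseIdx_of_lt hk, List.length_eraseIdx_of_lt hi.1, h.length_mid]

/-! ### Coxeter–Knuth moves at a given place -/

/-- The Coxeter–Knuth move on the letters at the indices `l, l + 1, l + 2`. It changes a reduced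
word exactly if one of the two pairs of adjacent letters is a descent and the other is not. -/
def ckMove : ℕ → List ℤ → List ℤ
  | 0, p :: q :: r :: B =>
    if (p < q ↔ q < r) then p :: q :: r :: B
    else if p = r then q :: p :: q :: B
    else if (p < r ↔ r < q) then q :: p :: r :: B
    else p :: r :: q :: B
  | l + 1, a :: t => a :: ckMove l t
  | _, w => w

theorem ckMove_append (A w : List ℤ) : ckMove A.length (A ++ w) = A ++ ckMove 0 w := by
  induction A with
  | nil => rfl
  | cons a t ih => simp [ckMove, ih]

theorem CK.ckMove_eq {t u : List ℤ} {π : Equiv.Perm ℕ} (h : CK t u π) (A B : List ℤ) :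
    ckMove A.length (A ++ t ++ B) = A ++ u ++ B := by
  rw [List.append_assoc, ckMove_append, List.append_assoc]
  congr 1
  rcases h with h | h <;> cases h <;> simp [ckMove] <;> (repeat' split_ifs) <;> simp <;> omega

theorem ckMove_of_length_le {w : List ℤ} {l : ℕ} (h : w.length ≤ l + 2) : ckMove l w = w := by
  induction w generalizing l with
  | nil => cases l <;> rfl
  | cons a t ih =>
    cases l with
    | zero =>
      match t, h with
      | [], _ => rfl
      | [b], _ => rfl
    | succ l => rw [ckMove, ih (by simpa using h)]

theorem exists_triple {w : List ℤ} {l : ℕ} (h : l + 2 < w.length) :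
    ∃ A p q r B, w = A ++ [p, q, r] ++ B ∧ A.length = l := by
  refine ⟨w.take l, w[l], w[l + 1], w[l + 2], w.drop (l + 3), ?_, by simp; omega⟩
  simp

theorem ckMove_eq_self {w : List ℤ} {l : ℕ} (h : l + 2 < w.length)
    (ha : w.getD l 0 < w.getD (l + 1) 0 ↔ w.getD (l + 1) 0 < w.getD (l + 2) 0) :
    ckMove l w = w := by
  obtain ⟨A, p, q, r, B, rfl, rfl⟩ := exists_triple h
  rw [List.append_assoc, ckMove_append]
  simp at ha
  simp [ckMove, ha]

theorem exists_ck {w : List ℤ} {l : ℕ} (h : l + 2 < w.length) (hw : ZReduced w)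
    (ha : ¬ (w.getD l 0 < w.getD (l + 1) 0 ↔ w.getD (l + 1) 0 < w.getD (l + 2) 0)) :
    ∃ A t u B π, CK t u π ∧ w = A ++ t ++ B ∧ A.length = l := by
  obtain ⟨A, p, q, r, B, rfl, rfl⟩ := exists_triple h
  have hr := hw.of_append_left.of_append_right
  simp at ha
  have hpq : p ≠ q := by
    rintro rfl
    have := hr.index_unique (by simp) (by simp) (crossings_three_01 p r)
    omega
  have hqr : q ≠ r := by
    rintro rfl
    have := hr.index_unique (by simp) (by simp) (crossings_three_12 p q)
    omega
  have hpr : p = r → q = p + 1 ∨ p = q + 1 := by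
    rintro rfl
    by_contra hc
    have := hr.index_unique (by simp) (by simp) (crossings_three_02 (p := p) (q := q) (by omega))
    omega
  suffices ∃ u π, CK [p, q, r] u π by
    obtain ⟨u, π, hck⟩ := this
    exact ⟨A, _, u, B, π, hck, rfl, rfl⟩
  rcases lt_trichotomy p r with h1 | rfl | h1
  · rcases lt_or_gt_of_ne hpq with h2 | h2
    · exact ⟨_, _, Or.inl (.left p r q h1 (by omega))⟩
    · exact ⟨_, _, Or.inl (.right q p r (by omega) h1)⟩
  · rcases hpr rfl with rfl | rfl
    · exact ⟨_, _, Or.inl (.braid _)⟩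
    · exact ⟨_, _, Or.inr (.braid _)⟩
  · rcases lt_or_gt_of_ne hpq with h2 | h2
    · exact ⟨_, _, Or.inr (.right r p q h1 h2)⟩
    · exact ⟨_, _, Or.inr (.left q r p (by omega) h1)⟩

/-- Bumps commute with Coxeter–Knuth moves. -/
theorem ZBump.map_ckMove {w v : List ℤ} (h : ZBump w v) (l : ℕ) :
    ZBump (ckMove l w) (ckMove l v) := by
  have hlen := h.length_eq
  by_cases hl : l + 2 < w.length
  · by_cases ha : w.getD l 0 < w.getD (l + 1) 0 ↔ w.getD (l + 1) 0 < w.getD (l + 2) 0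
    · rw [ckMove_eq_self hl ha, ckMove_eq_self (by omega)]
      · exact h
      · rw [← (h.lt_iff (by omega)).1, ← (h.lt_iff (l := l + 1) (by omega)).1]
        exact ha
    · obtain ⟨A, t, u, B, π, hck, rfl, rfl⟩ := exists_ck hl h.1 ha
      obtain ⟨A', t', u', B', ρ, hck', hA, rfl, hb⟩ := ZBump.exists_related hck h
      rw [hck.ckMove_eq, ← hA, hck'.ckMove_eq]
      exact hb
  · rw [ckMove_of_length_le (by omega), ckMove_of_length_le (by omega)]
    exact h

/-! ### The descents seen along Coxeter–Knuth moves -/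

/-- Apply Coxeter–Knuth moves at the given places, one after the other. -/
def ckMoves (ms : List ℕ) (w : List ℤ) : List ℤ := ms.foldl (fun w l => ckMove l w) w

/-- Two words of the same length have the same descents, and keep having the same descents
whatever Coxeter–Knuth moves are applied to both of them. -/
def SameDescents (w v : List ℤ) : Prop :=
  w.length = v.length ∧ ∀ (ms : List ℕ) (l : ℕ), l + 1 < w.length →
    ((ckMoves ms w).getD (l + 1) 0 < (ckMoves ms w).getD l 0 ↔
      (ckMoves ms v).getD (l + 1) 0 < (ckMoves ms v).getD l 0)

theorem ckMoves_append (ms ns : List ℕ) (w : List ℤ) :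
    ckMoves (ms ++ ns) w = ckMoves ns (ckMoves ms w) := by
  simp [ckMoves]

theorem length_ckMove (l : ℕ) (w : List ℤ) : (ckMove l w).length = w.length := by
  induction w generalizing l with
  | nil => cases l <;> rfl
  | cons a t ih =>
    cases l with
    | zero =>
      match t with
      | [] => rfl
      | [b] => rfl
      | q :: r :: B => simp only [ckMove]; split_ifs <;> simp
    | succ l => simp [ckMove, ih]

theorem length_ckMoves (ms : List ℕ) (w : List ℤ) : (ckMoves ms w).length = w.length := by
  induction ms generalizing w with
  | nil => rfl
  | cons l ms ih => rw [ckMoves, List.foldl_cons, ← ckMoves, ih, length_ckMove]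

theorem ckMoves_cons (ms : List ℕ) (a : ℤ) (t : List ℤ) :
    ckMoves (ms.map (· + 1)) (a :: t) = a :: ckMoves ms t := by
  induction ms generalizing t with
  | nil => rfl
  | cons l ms ih =>
    simp only [ckMoves, List.map_cons, List.foldl_cons, ckMove]
    exact ih _

theorem ckMove_map_add (d : ℤ) (l : ℕ) (w : List ℤ) :
    ckMove l (w.map (· + d)) = (ckMove l w).map (· + d) := by
  induction w generalizing l with
  | nil => cases l <;> rfl
  | cons a t ih =>
    cases l with
    | zero =>
      match t with
      | [] => rfl
      | [b] => rfl
      | q :: r :: B =>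
        simp only [ckMove, List.map_cons, add_lt_add_iff_right, add_left_inj]
        split_ifs <;> simp
    | succ l => simp [ckMove, ← ih]

theorem ckMoves_map_add (d : ℤ) (ms : List ℕ) (w : List ℤ) :
    ckMoves ms (w.map (· + d)) = (ckMoves ms w).map (· + d) := by
  induction ms generalizing w with
  | nil => rfl
  | cons l ms ih =>
    simp only [ckMoves, List.foldl_cons, ckMove_map_add]
    exact ih _

theorem SameDescents.symm {w v : List ℤ} (h : SameDescents w v) : SameDescents v w :=
  ⟨h.1.symm, fun ms l hl => (h.2 ms l (by rw [h.1]; exact hl)).symm⟩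

theorem SameDescents.trans {w v u : List ℤ} (h : SameDescents w v) (h' : SameDescents v u) :
    SameDescents w u :=
  ⟨h.1.trans h'.1, fun ms l hl => (h.2 ms l hl).trans (h'.2 ms l (by rw [← h.1]; exact hl))⟩

theorem sameDescents_map_add (d : ℤ) (w : List ℤ) : SameDescents w (w.map (· + d)) := by
  refine ⟨by simp, fun ms l hl => ?_⟩
  have hl' : l + 1 < (ckMoves ms w).length := by rwa [length_ckMoves]
  rw [ckMoves_map_add]
  simp [hl', (by omega : l < (ckMoves ms w).length)]

theorem SameDescents.tail {a b : ℤ} {t u : List ℤ} (h : SameDescents (a :: t) (b :: u)) :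
    SameDescents t u := by
  refine ⟨by simpa using h.1, fun ms l hl => ?_⟩
  simpa [ckMoves_cons] using h.2 (ms.map (· + 1)) (l + 1) (by simpa using hl)

/-- Bumps preserve descents and commute with Coxeter–Knuth moves. -/
theorem ZBump.sameDescents {w v : List ℤ} (h : ZBump w v) : SameDescents w v := by
  refine ⟨h.length_eq.symm, fun ms l hl => ?_⟩
  have : ZBump (ckMoves ms w) (ckMoves ms v) := by
    clear hl
    induction ms generalizing w v with
    | nil => exact h
    | cons l ms ih => exact ih (h.map_ckMove l)
  exact (this.lt_iff (by rwa [length_ckMoves])).2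

/-! ### Grassmannian words over the integers -/

/-- The value `x` stands at a position up to `k` in the permutation of `w`. -/
def Occupied (k : ℤ) (w : List ℤ) (x : ℤ) : Prop := (zperm w)⁻¹ x ≤ k

/-- In the permutation of the letters after it, each letter `a` finds the value `a` at a position
up to `k` and the value `a + 1` at a position beyond `k`. These are the reduced words of the
permutations without descents other than `k`; read backwards, they list the letters `k + j - i` of
the cells `(i, j)` of a standard tableau, in the order of the entries. -/
def GrassmannianAt (k : ℤ) : List ℤ → Prop
  | [] => True
  | a :: t => GrassmannianAt k t ∧ Occupied k t a ∧ ¬ Occupied k t (a + 1)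

theorem occupied_cons {k a x : ℤ} {t : List ℤ} :
    Occupied k (a :: t) x ↔ Occupied k t (zsimple a x) := by
  simp [Occupied]

theorem exists_step_of_not_of {P : ℤ → Prop} {x y : ℤ} (hxy : x ≤ y) (hx : ¬ P x) (hy : P y) :
    ∃ d, x ≤ d ∧ d < y ∧ ¬ P d ∧ P (d + 1) := by
  by_contra hc
  push Not at hc
  have : ∀ n : ℕ, x + n ≤ y → ¬ P (x + n) := by
    intro n
    induction n with
    | zero => simpa using fun _ => hx
    | succ n ih =>
      intro hn
      push_cast at hn ⊢
      have := hc (x + n) (by omega) (by omega) (ih (by omega))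
      rwa [← add_assoc]
  have h := this (y - x).toNat (by omega)
  rw [show x + ((y - x).toNat : ℤ) = y by omega] at h
  exact h hy

/-- Coxeter–Knuth moves bring to the front any letter at the front of some reduced word of the
same Grassmannian permutation. If the front letter is `c` instead of `b`, then `b` can be brought
to the second place and a letter strictly between `b` and `c` to the third, so that one more move
exchanges `b` and `c`. -/
theorem GrassmannianAt.exists_ckMoves {k : ℤ} {t : List ℤ} (ht : GrassmannianAt k t) {b : ℤ}
    (hb : ¬ Occupied k t b) (hb' : Occupied k t (b + 1)) :
    ∃ ms t', ckMoves ms t = b :: t' ∧ GrassmannianAt k (b :: t') ∧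
      ∀ x, Occupied k (b :: t') x ↔ Occupied k t x := by
  induction hn : t.length using Nat.strong_induction_on generalizing t b with
  | _ n ih =>
  cases t with
  | nil =>
    simp [Occupied] at hb hb'
    omega
  | cons c t₁ =>
    rcases eq_or_ne c b with rfl | hcb
    · exact ⟨[], t₁, rfl, ht, fun _ => Iff.rfl⟩
    obtain ⟨ht₁, hc, hc'⟩ := ht
    have hne : b ≠ c + 1 := by
      rintro rfl
      rw [occupied_cons, zsimple_of_eq_succ rfl] at hb
      exact hb hc
    have hne' : c ≠ b + 1 := by
      rintro rfl
      rw [occupied_cons, zsimple_of_eq rfl] at hb'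
      exact hc' hb'
    have hfix : ∀ {a x : ℤ}, x ≠ a → x ≠ a + 1 → zsimple a x = x := fun h1 h2 => by
      rw [zsimple_apply, if_neg h1, if_neg h2]
    rw [occupied_cons, hfix (by omega) (by omega)] at hb hb'
    obtain ⟨ms, t₂, hms, hg, hocc⟩ := ih t₁.length (by simp [← hn]) ht₁ hb hb' rfl
    obtain ⟨ht₂, h2b, h2b'⟩ := hg
    have h2c : Occupied k t₂ c := by
      have := (hocc c).2 hc
      rwa [occupied_cons, hfix (by omega) (by omega)] at this
    have h2c' : ¬ Occupied k t₂ (c + 1) := by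
      have := mt (hocc (c + 1)).1 hc'
      rwa [occupied_cons, hfix (by omega) (by omega)] at this
    obtain ⟨d, hd, hd1, hd2⟩ : ∃ d, (b < d ∧ d < c ∨ c < d ∧ d < b) ∧
        ¬ Occupied k t₂ d ∧ Occupied k t₂ (d + 1) := by
      rcases lt_or_gt_of_ne hcb with h | h
      · obtain ⟨d, h1, h2, h3, h4⟩ := exists_step_of_not_of (by omega : c + 1 ≤ b) h2c' h2b
        exact ⟨d, by omega, h3, h4⟩
      · obtain ⟨d, h1, h2, h3, h4⟩ := exists_step_of_not_of (by omega : b + 1 ≤ c) h2b' h2c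
        exact ⟨d, by omega, h3, h4⟩
    have hl₂ : t₂.length < n := by
      have := congrArg List.length hms
      simp only [length_ckMoves, List.length_cons] at this hn
      omega
    obtain ⟨ns, t₃, hns, hg₃, hocc₃⟩ := ih t₂.length hl₂ ht₂ hd1 hd2 rfl
    refine ⟨ms.map (· + 1) ++ ((ns.map (· + 1)).map (· + 1) ++ [0]), c :: d :: t₃, ?_,
      ⟨⟨hg₃, ?_, ?_⟩, ?_, ?_⟩, fun x => ?_⟩
    · rw [ckMoves_append, ckMoves_append, ckMoves_cons, hms, ckMoves_cons, ckMoves_cons, hns]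
      simp only [ckMoves, List.foldl_cons, List.foldl_nil, ckMove]
      rw [if_neg (by omega), if_neg (by omega), if_pos (by omega)]
    · exact (hocc₃ _).2 h2c
    · exact mt (hocc₃ _).1 h2c'
    · rw [occupied_cons, hfix (by omega) (by omega)]
      exact (hocc₃ _).2 h2b
    · rw [occupied_cons, hfix (by omega) (by omega)]
      exact mt (hocc₃ _).1 h2b'
    · rw [occupied_cons, occupied_cons, hocc₃, occupied_cons, ← hocc, occupied_cons]
      have hcomm : zsimple c * zsimple b = zsimple b * zsimple c := by
        rcases lt_or_gt_of_ne hcb with h | h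
        · exact zsimple_mul_comm (by omega)
        · exact (zsimple_mul_comm (by omega)).symm
      rw [← Equiv.Perm.mul_apply, hcomm, Equiv.Perm.mul_apply]

/-- Suppose that two words of this kind agree except in their first letters `a < b`. Some letter
strictly between `a` and `b` can be brought to the second place, and then only one of the two
words has a descent at its first place. -/
theorem GrassmannianAt.eq_of_sameDescents {k : ℤ} {w v : List ℤ} (hw : GrassmannianAt k w)
    (hv : GrassmannianAt k v) (h : SameDescents w v) : w = v := by
  induction w generalizing v with
  | nil => simpa [eq_comm] using h.1
  | cons a t ih =>
    cases v with
    | nil => simpa using h.1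
    | cons b u =>
      obtain rfl := ih hw.1 hv.1 h.tail
      have key : ∀ {a b : ℤ}, GrassmannianAt k (a :: t) → GrassmannianAt k (b :: t) →
          SameDescents (a :: t) (b :: t) → ¬ a < b := by
        intro a b ha hb h hab
        obtain ⟨d, h1, h2, h3, h4⟩ := exists_step_of_not_of (by omega : a + 1 ≤ b) ha.2.2 hb.2.1
        obtain ⟨ms, t', hms, -, -⟩ := ha.1.exists_ckMoves h3 h4
        have hl : 0 + 1 < (a :: t).length := by
          have := congrArg List.length hms
          rw [length_ckMoves] at this
          simp [this]
        have := h.2 (ms.map (· + 1)) 0 hl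
        rw [ckMoves_cons, ckMoves_cons, hms] at this
        simp at this
        omega
      have h1 := key hw hv h
      have h2 := key hv hw h.symm
      rw [show a = b by omega]

theorem ZReduced.grassmannianAt {k : ℤ} {w : List ℤ} (hw : ZReduced w)
    (h1 : ∀ x y, x < y → y ≤ k → zperm w x < zperm w y)
    (h2 : ∀ x y, x < y → k < x → zperm w x < zperm w y) : GrassmannianAt k w := by
  induction w with
  | nil => trivial
  | cons a t ih =>
    have ht : ZReduced t := ZReduced.of_append_right (X := [a]) hw
    have hinv := hw.inverted_of_mem (p := a) (q := a + 1) (by simp)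
    obtain ⟨P, hP⟩ : ∃ P, zperm (a :: t) P = a + 1 := (zperm (a :: t)).surjective _
    obtain ⟨Q, hQ⟩ : ∃ Q, zperm (a :: t) Q = a := (zperm (a :: t)).surjective _
    have hP' : (zperm (a :: t))⁻¹ (a + 1) = P := by rw [Equiv.Perm.inv_eq_iff_eq, hP]
    have hQ' : (zperm (a :: t))⁻¹ a = Q := by rw [Equiv.Perm.inv_eq_iff_eq, hQ]
    have hPQ : P ≠ Q := by rintro rfl; omega
    rw [Inverted, hP', hQ'] at hinv
    have hPk : P ≤ k := by
      by_contra hc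
      have := h2 P Q (by omega) (by omega)
      omega
    have hQk : k < Q := by
      by_contra hc
      have := h1 P Q (by omega) (by omega)
      omega
    have hval : ∀ x, zperm t x = zsimple a (zperm (a :: t) x) := by simp
    have hinj : ∀ x y, zperm (a :: t) x = zperm (a :: t) y → x = y :=
      fun x y h => (zperm (a :: t)).injective h
    refine ⟨ih ht ?_ ?_, ?_, ?_⟩
    · intro x y hxy hy
      have hlt := h1 x y hxy hy
      have hx : zperm (a :: t) x ≠ a := fun h => by
        have := hinj x Q (by omega)
        omega
      rw [hval, hval, zsimple_apply, zsimple_apply]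
      split_ifs <;> omega
    · intro x y hxy hy
      have hlt := h2 x y hxy hy
      have hx : zperm (a :: t) y ≠ a + 1 := fun h => by
        have := hinj y P (by omega)
        omega
      rw [hval, hval, zsimple_apply, zsimple_apply]
      split_ifs <;> omega
    · have : zperm t P = a := by rw [hval, hP, zsimple_of_eq_succ rfl]
      rw [Occupied, ← this]
      simpa using hPk
    · have : zperm t Q = a + 1 := by rw [hval, hQ, zsimple_of_eq rfl]
      rw [Occupied, ← this]
      simpa using hQk

/-! ### Words of natural numbers as integer words -/

/-- The integer word with the letters of `w` increased by `c`. Renormalizations of the letters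
in a Little bump change `c`. -/
def shift (c : ℤ) (w : List ℕ) : List ℤ := w.map fun a : ℕ => (a : ℤ) + c

@[simp] theorem length_shift (c : ℤ) (w : List ℕ) : (shift c w).length = w.length := by
  simp [shift]

theorem perm_cons (a : ℕ) (w : List ℕ) : perm (a :: w) = simple a * perm w := by
  simp [perm]

theorem zperm_shift (c : ℤ) (w : List ℕ) (n : ℕ) :
    zperm (shift c w) (n + c) = perm w n + c := by
  induction w with
  | nil => simp [shift, perm]
  | cons a w ih =>
    rw [shift, List.map_cons, ← shift, zperm_cons, Equiv.Perm.mul_apply, ih, perm_cons,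
      Equiv.Perm.mul_apply, zsimple_apply, simple, Equiv.swap_apply_def]
    split_ifs <;> omega

theorem zperm_shift_of_lt {c x : ℤ} (w : List ℕ) (hx : x < c) : zperm (shift c w) x = x := by
  refine zperm_apply_of_lt (m := c) (fun a ha => ?_) hx
  obtain ⟨b, -, rfl⟩ := List.mem_map.1 ha
  omega

theorem zperm_shift_inj {c : ℤ} {u w : List ℕ} :
    zperm (shift c u) = zperm (shift c w) ↔ perm u = perm w := by
  refine ⟨fun h => ?_, fun h => ?_⟩
  · ext n
    have := congrArg (fun σ => σ ((n : ℤ) + c)) h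
    simp only [zperm_shift] at this
    omega
  · ext x
    rcases lt_or_ge x c with hx | hx
    · rw [zperm_shift_of_lt _ hx, zperm_shift_of_lt _ hx]
    · obtain ⟨n, rfl⟩ : ∃ n : ℕ, x = n + c := ⟨(x - c).toNat, by omega⟩
      rw [zperm_shift, zperm_shift, h]

theorem crossings_shift (c : ℤ) {w : List ℕ} {l : ℕ} (hl : l < w.length) :
    (crossings (shift c w))[l]? = some (Sym2.map (fun n : ℕ => (n : ℤ) + c) (swapped w l)) := by
  have hw : shift c w = shift c (w.take l) ++ ((w[l] : ℤ) + c) :: shift c (w.drop (l + 1)) := by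
    rw [shift, shift, shift, ← List.map_cons (f := fun a : ℕ => (a : ℤ) + c), ← List.map_append]
    simp
  have h := getElem?_crossings_length (shift c (w.take l)) ((w[l] : ℤ) + c)
    (shift c (w.drop (l + 1)))
  rw [← hw, length_shift, List.length_take_of_le hl.le,
    show (w[l] : ℤ) + c + 1 = ((w[l] + 1 : ℕ) : ℤ) + c by push_cast; ring,
    zperm_shift, zperm_shift] at h
  rw [h]
  simp [swapped, hl]

theorem cast_add_injective (c : ℤ) :
    Function.Injective (Sym2.map (fun n : ℕ => (n : ℤ) + c)) :=
  Sym2.map.injective fun a b h => by simpa using h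

theorem crossings_shift_inj {c : ℤ} {w : List ℕ} {i j : ℕ} (hi : i < w.length)
    (hj : j < w.length) :
    (crossings (shift c w))[i]? = (crossings (shift c w))[j]? ↔ swapped w i = swapped w j := by
  rw [crossings_shift c hi, crossings_shift c hj, Option.some_inj]
  exact (cast_add_injective c).eq_iff

theorem isReduced_iff (c : ℤ) (w : List ℕ) :
    IsReduced w ↔ (∀ a ∈ w, 1 ≤ a) ∧ ZReduced (shift c w) := by
  refine and_congr_right fun hw => ⟨fun h => ?_, fun h u _ hu => ?_⟩
  · by_contra hn
    obtain ⟨z, hz, hz1, hz2⟩ := exists_sublist_of_not_zreduced hn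
    obtain ⟨u, hu, rfl⟩ := List.sublist_map_iff.1 hz
    have := h u (fun a ha => hw a (hu.subset ha)) (zperm_shift_inj.1 hz1)
    simp at hz2
    omega
  · simpa using h.length_le (zperm_shift_inj (c := c).2 hu)

theorem IsReduced.zreduced {w : List ℕ} (h : IsReduced w) (c : ℤ) : ZReduced (shift c w) :=
  ((isReduced_iff c w).1 h).2

theorem exists_shift_decrement (c : ℤ) {w : List ℕ} (hw : ∀ a ∈ w, 1 ≤ a) {j : ℕ}
    (hj : j < w.length) :
    (∀ a ∈ decrement w j, 1 ≤ a) ∧ ∃ c', shift c' (decrement w j) = dec (shift c w) j := by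
  have hwj : w.getD j 0 = w[j] := by simp [hj]
  have hp := hw w[j] (by simp)
  rw [decrement, hwj]
  split_ifs with h
  · refine ⟨fun a ha => ?_, c, ?_⟩
    · rcases List.mem_or_eq_of_mem_set ha with ha | rfl
      · exact hw a ha
      · omega
    · rw [shift, List.map_set, ← shift, dec]
      congr 1
      simp [shift, hj]
      omega
  · refine ⟨fun a ha => ?_, c - 1, ?_⟩
    · rcases List.mem_or_eq_of_mem_set ha with ha | rfl
      · obtain ⟨b, -, rfl⟩ := List.mem_map.1 ha
        omega
      · omega
    · rw [shift, List.map_set, List.map_map, dec, shift]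
      congr 1
      · refine List.map_congr_left fun a _ => ?_
        simp
      · simp [hj]
        omega

theorem length_decrement (w : List ℕ) (j : ℕ) : (decrement w j).length = w.length := by
  rw [decrement]
  split_ifs <;> simp

theorem BumpsTo.exists_settles {u : List ℕ} {j : ℕ} {v : List ℕ} (h : BumpsTo u j v) (c : ℤ)
    (hu : ∀ a ∈ u, 1 ≤ a) (hj : j < u.length) :
    ∃ n c', Settles n (dec (shift c u) j) j (shift c' v) := by
  induction h generalizing c with
  | done u j h =>
    obtain ⟨-, c', hc'⟩ := exists_shift_decrement c hu hj
    rw [← hc']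
    exact ⟨0, c', .done _ _ (h.zreduced c')⟩
  | next u j j' v h hlt hne hs hv ih =>
    obtain ⟨hpos, c', hc'⟩ := exists_shift_decrement c hu hj
    rw [← hc']
    have hl := length_decrement u j
    obtain ⟨n, d, hd⟩ := ih c' hpos (by omega)
    refine ⟨n + 1, d, .next n _ _ j' _ (fun hr => h ((isReduced_iff c' _).2 ⟨hpos, hr⟩))
      (by simpa [hl] using hlt) hne ?_ hd⟩
    rwa [crossings_shift_inj (by omega) (by omega)]

theorem Settles.exists_bumpsTo {n : ℕ} {y : List ℤ} {j : ℕ} {z : List ℤ} (h : Settles n y j z)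
    (c : ℤ) {u : List ℕ} (hu : ∀ a ∈ u, 1 ≤ a) (hj : j < u.length)
    (hy : y = dec (shift c u) j) : ∃ v c', z = shift c' v ∧ BumpsTo u j v := by
  induction h generalizing c u with
  | done y j h =>
    subst hy
    obtain ⟨hpos, c', hc'⟩ := exists_shift_decrement c hu hj
    rw [← hc'] at h ⊢
    exact ⟨_, c', rfl, .done u j ((isReduced_iff c' _).2 ⟨hpos, h⟩)⟩
  | next n y j j' v h hlt hne hc hv ih =>
    subst hy
    obtain ⟨hpos, c', hc'⟩ := exists_shift_decrement c hu hj
    have hl := length_decrement u j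
    rw [← hc'] at h hlt hc ih
    simp only [length_shift, hl] at hlt
    obtain ⟨v', d, rfl, hb⟩ := ih c' hpos (by omega) rfl
    refine ⟨v', d, rfl, .next u j j' v' (fun hr => h (hr.zreduced c')) hlt hne ?_ hb⟩
    rwa [crossings_shift_inj (by omega) (by omega)] at hc

theorem shift_eraseIdx (c : ℤ) (w : List ℕ) (i : ℕ) :
    shift c (w.eraseIdx i) = (shift c w).eraseIdx i := by
  rw [shift, shift, List.eraseIdx_map]

theorem IsLittleBump.exists_zbump {w : List ℕ} {i : ℕ} {v : List ℕ} (h : IsLittleBump w i v)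
    (c : ℤ) : ∃ c', ZBump (shift c w) (shift c' v) := by
  obtain ⟨hw, hi, he, hb⟩ := h
  obtain ⟨n, c', hs⟩ := hb.exists_settles c hw.1 hi
  exact ⟨c', hw.zreduced c, i, n, ⟨by simpa, by rw [← shift_eraseIdx]; exact he.zreduced c⟩, hs⟩

theorem shift_eq_map_shift (c d : ℤ) (w : List ℕ) :
    shift d w = (shift c w).map (· + (d - c)) := by
  simp [shift]

theorem sameDescents_shift (c d : ℤ) (w : List ℕ) : SameDescents (shift c w) (shift d w) := by
  rw [shift_eq_map_shift c d]
  exact sameDescents_map_add _ _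

theorem sameDescents_of_bumps {w v : List ℕ}
    (h : Relation.ReflTransGen (fun x y => ∃ i, IsLittleBump x i y) w v) (c d : ℤ) :
    SameDescents (shift c w) (shift d v) := by
  induction h generalizing d with
  | refl => exact sameDescents_shift c d w
  | tail _ hs ih =>
    obtain ⟨i, hi⟩ := hs
    obtain ⟨e, he⟩ := hi.exists_zbump c
    exact ((ih c).trans he.sameDescents).trans (sameDescents_shift e d _)

/-! ### Grassmannian words and their tableaux -/

theorem perm_zero {w : List ℕ} (hw : ∀ a ∈ w, 1 ≤ a) : perm w 0 = 0 := by
  induction w with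
  | nil => rfl
  | cons a w ih =>
    have := hw a (by simp)
    rw [perm_cons, Equiv.Perm.mul_apply, ih (fun b hb => hw b (by simp [hb])), simple,
      Equiv.swap_apply_of_ne_of_ne (by omega) (by omega)]

theorem lt_of_forall_lt_succ {f : ℤ → ℤ} {x y : ℤ} (hxy : x < y)
    (h : ∀ z, x ≤ z → z < y → f z < f (z + 1)) : f x < f y := by
  obtain ⟨n, rfl⟩ : ∃ n : ℕ, y = x + n + 1 := ⟨(y - x - 1).toNat, by omega⟩
  clear hxy
  induction n with
  | zero => simpa using h x le_rfl (by simp)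
  | succ n ih =>
    refine (ih fun z h1 h2 => h z h1 (by push_cast; omega)).trans ?_
    have := h (x + n + 1) (by omega) (by push_cast; omega)
    simpa [add_assoc] using this

/-- Below a position `c`, and at `c` itself, the permutation of a shifted word is the identity,
so its descents are those of the original permutation. -/
theorem zperm_shift_lt_succ (c : ℤ) {w : List ℕ} (hw : ∀ a ∈ w, 1 ≤ a) {x : ℤ}
    (h : ∀ n : ℕ, x = n + c → ¬ IsDescent (perm w) n) :
    zperm (shift c w) x < zperm (shift c w) (x + 1) := by
  have h0 := perm_zero hw
  have hc := zperm_shift c w 0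
  rw [h0, Nat.cast_zero, zero_add] at hc
  rcases lt_trichotomy (x + 1) c with hx | hx | hx
  · rw [zperm_shift_of_lt _ hx, zperm_shift_of_lt _ (by omega)]
    omega
  · rw [hx, hc, zperm_shift_of_lt _ (by omega)]
    omega
  · obtain ⟨n, rfl⟩ : ∃ n : ℕ, x = n + c := ⟨(x - c).toNat, by omega⟩
    rw [show (n : ℤ) + c + 1 = ((n + 1 : ℕ) : ℤ) + c by push_cast; ring, zperm_shift, zperm_shift]
    have hd := h n rfl
    have hne : perm w n ≠ perm w (n + 1) := by simp
    rcases Nat.eq_zero_or_pos n with rfl | hn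
    · omega
    · simp only [IsDescent, IsInversion, not_and, not_lt] at hd
      have := hd hn (by omega)
      omega

theorem IsGrassmannian.grassmannianAt {w : List ℕ} (h : IsGrassmannian w) {k : ℕ}
    (hk : IsDescent (perm w) k) (c : ℤ) : GrassmannianAt (k + c) (shift c w) := by
  have hs : ∀ x, x ≠ k + c → zperm (shift c w) x < zperm (shift c w) (x + 1) := by
    intro x hx
    refine zperm_shift_lt_succ c h.1.1 fun n hn hd => hx ?_
    rw [hn, h.2.unique hd hk]
  refine (h.1.zreduced c).grassmannianAt (fun x y hxy hy => ?_) (fun x y hxy hy => ?_)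
  · exact lt_of_forall_lt_succ hxy fun z _ _ => hs z (by omega)
  · exact lt_of_forall_lt_succ hxy fun z _ _ => hs z (by omega)

theorem perm_map_add (d : ℕ) (w : List ℕ) (n : ℕ) :
    perm (w.map (· + d)) (n + d) = perm w n + d := by
  induction w with
  | nil => rfl
  | cons a w ih =>
    rw [List.map_cons, perm_cons, perm_cons, Equiv.Perm.mul_apply, ih, Equiv.Perm.mul_apply,
      simple, simple, Equiv.swap_apply_def, Equiv.swap_apply_def]
    split_ifs <;> omega

theorem perm_map_add_of_lt {d : ℕ} (w : List ℕ) {n : ℕ} (hn : n < d) :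
    perm (w.map (· + d)) n = n := by
  induction w with
  | nil => rfl
  | cons a w ih =>
    rw [List.map_cons, perm_cons, Equiv.Perm.mul_apply, ih, simple,
      Equiv.swap_apply_of_ne_of_ne (by omega) (by omega)]

theorem swapped_map_add (d : ℕ) {w : List ℕ} {l : ℕ} (hl : l < w.length) :
    swapped (w.map (· + d)) l = Sym2.map (· + d) (swapped w l) := by
  have h1 : (w.map (· + d)).getD l 0 = w.getD l 0 + d := by simp [hl]
  rw [swapped, swapped, h1, ← List.map_take, perm_map_add, add_right_comm, perm_map_add]
  simp

theorem zero_notMem_swapped {w : List ℕ} (hw : ∀ a ∈ w, 1 ≤ a) {l : ℕ} (hl : l < w.length) :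
    0 ∉ swapped w l := by
  have hp : 1 ≤ w.getD l 0 := hw _ (by simp [hl])
  have h0 : perm (w.take l) 0 = 0 := perm_zero fun a ha => hw a (List.mem_of_mem_take ha)
  intro h
  rw [swapped, Sym2.mem_iff] at h
  rcases h with h | h <;>
  · have := (perm (w.take l)).injective (h0.trans h)
    omega

theorem isDescent_map_add {d : ℕ} {w : List ℕ} (hw : ∀ a ∈ w, 1 ≤ a) {i : ℕ} :
    IsDescent (perm (w.map (· + d))) i ↔ d ≤ i ∧ IsDescent (perm w) (i - d) := by
  have h0 := perm_zero hw
  rcases lt_or_ge i d with hi | hi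
  · have h1 := perm_map_add_of_lt w hi
    have h2 : perm (w.map (· + d)) (i + 1) = i + 1 := by
      rcases (by omega : i + 1 < d ∨ i + 1 = d) with h | h
      · exact perm_map_add_of_lt w h
      · have := perm_map_add d w 0
        rw [h0, zero_add] at this
        rwa [h]
    simp only [IsDescent, IsInversion, h1, h2]
    omega
  · obtain ⟨n, rfl⟩ : ∃ n, i = n + d := ⟨i - d, by omega⟩
    have h1 := perm_map_add d w n
    have h2 := perm_map_add d w (n + 1)
    rw [add_right_comm] at h2
    simp only [IsDescent, IsInversion, h1, h2, Nat.add_sub_cancel]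
    rcases Nat.eq_zero_or_pos n with rfl | hn
    · rw [h0]
      omega
    · omega

theorem tab_map_add {w : List ℕ} (h : IsGrassmannian w) (d : ℕ) : tab (w.map (· + d)) = tab w := by
  obtain ⟨k, hk, hu⟩ := h.2
  have hw := h.1.1
  have e1 : {i | IsDescent (perm w) i} = {k} := by
    ext i
    exact ⟨fun hi => hu i hi, fun hi => hi ▸ hk⟩
  have e2 : {i | IsDescent (perm (w.map (· + d))) i} = {k + d} := by
    ext i
    simp only [isDescent_map_add hw, Set.mem_ofPred_eq, Set.mem_singleton_iff]
    refine ⟨fun ⟨h1, h2⟩ => ?_, ?_⟩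
    · have := hu _ h2
      omega
    · rintro rfl
      exact ⟨by omega, by simpa using hk⟩
  funext r c
  simp only [tab, e1, e2, csInf_singleton, List.length_map]
  by_cases hr : r < k
  · rw [if_pos hr, if_pos (by omega)]
    congr 1
    refine List.find?_congr fun l hl => ?_
    have hl' : l < w.length := by simpa using hl
    rw [swapped_map_add d hl', show k + d - r = k - r + d by omega,
      show k + d + 1 + c = k + 1 + c + d by omega, perm_map_add, perm_map_add]
    have : s(perm w (k - r) + d, perm w (k + 1 + c) + d)
        = Sym2.map (· + d) s(perm w (k - r), perm w (k + 1 + c)) := by simp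
    rw [this]
    exact decide_eq_decide.2 (Sym2.map.injective (add_left_injective d)).eq_iff
  · rw [if_neg hr]
    by_cases hr' : r < k + d
    · -- The row belongs to a position up to `d`, whose value is fixed and never exchanged.
      rw [if_pos hr', List.find?_eq_none.2]
      intro l hl
      have hl' : l < w.length := by simpa using hl
      have hfix : perm (w.map (· + d)) (k + d - r) = k + d - r := by
        rcases (by omega : k + d - r < d ∨ k + d - r = d) with h | h
        · exact perm_map_add_of_lt w h
        · have := perm_map_add d w 0
          rw [perm_zero hw, zero_add] at this
          rwa [h]
      rw [hfix, swapped_map_add d hl', decide_eq_true_eq]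
      intro he
      have hm : k + d - r ∈ Sym2.map (· + d) (swapped w l) := by
        rw [he]
        simp
      obtain ⟨x, hx, hx2⟩ := Sym2.mem_map.1 hm
      have : x ≠ 0 := by
        rintro rfl
        exact zero_notMem_swapped hw hl' hx
      omega
    · rw [if_neg hr']

theorem IsGrassmannian.tab_eq {w v : List ℕ} (hw : IsGrassmannian w) (hv : IsGrassmannian v)
    {c d : ℤ} (h : SameDescents (shift c w) (shift d v)) : tab w = tab v := by
  obtain ⟨k, hk, -⟩ := hw.2
  obtain ⟨m, hm, -⟩ := hv.2
  have h1 := hw.grassmannianAt hk (-k)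
  have h2 := hv.grassmannianAt hm (-m)
  rw [add_neg_cancel] at h1 h2
  have h3 := h1.eq_of_sameDescents h2
    (((sameDescents_shift _ c w).trans h).trans (sameDescents_shift d _ v))
  have key : ∀ {w v : List ℕ} {k m : ℕ}, IsGrassmannian w → k ≤ m →
      shift (-k) w = shift (-m) v → tab w = tab v := by
    intro w v k m hw hkm h
    have : v = w.map (· + (m - k)) := by
      have hinj : Function.Injective fun a : ℕ => (a : ℤ) + -m := fun a b hab => by
        simpa using hab
      refine List.map_injective_iff.2 hinj ?_
      rw [shift, shift] at h
      rw [← h, List.map_map]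
      refine List.map_congr_left fun a _ => ?_
      simp only [Function.comp]
      omega
    rw [this, tab_map_add hw]
  rcases le_total k m with hkm | hkm
  · exact key hw hkm h3
  · exact (key hv hkm h3.symm).symm

/-! ### The wire followed by a bump -/

/-- In a reduced word, the smaller one of two values stands to the left when they are exchanged,
since they have not been exchanged before. -/
theorem ZReduced.apply_lt_apply_succ {X Y : List ℤ} {a : ℤ} (h : ZReduced (X ++ a :: Y)) :
    zperm X a < zperm X (a + 1) := by
  by_contra hc
  have hne : zperm X a ≠ zperm X (a + 1) := by simp
  have hinv : Inverted (zperm X) (zperm X a) (zperm X (a + 1)) := by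
    have h1 : (zperm X)⁻¹ (zperm X a) = a := by simp
    have h2 : (zperm X)⁻¹ (zperm X (a + 1)) = a + 1 := by simp
    simp only [Inverted, h1, h2]
    omega
  have := mem_crossings_of_inverted hne hinv
  rw [ZReduced, crossings_append_cons, List.nodup_append] at h
  exact h.2.2 _ this _ (by simp) rfl

theorem zperm_eraseIdx_length (X : List ℤ) (a : ℤ) (Y : List ℤ) :
    zperm ((X ++ a :: Y).eraseIdx X.length) = zperm (X ++ Y) := by
  rw [eraseIdx_append_cons]

/-- If a pair of values is exchanged twice, the second exchange happens in reverse order. -/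
theorem NearlyReduced.apply_eq {X M Y : List ℤ} {a b : ℤ}
    (h : NearlyReduced (X ++ a :: (M ++ b :: Y)) X.length)
    (hc : s(zperm (X ++ a :: M) b, zperm (X ++ a :: M) (b + 1)) =
      s(zperm X a, zperm X (a + 1))) :
    zperm (X ++ a :: M) b = zperm X (a + 1) ∧ zperm (X ++ a :: M) (b + 1) = zperm X a := by
  have e : X ++ a :: (M ++ b :: Y) = (X ++ a :: M) ++ b :: Y := by simp
  have h1 : ZReduced (X ++ (M ++ b :: Y)) := by
    have := h.2
    rwa [eraseIdx_append_cons] at this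
  have h2 : ZReduced (X ++ a :: (M ++ Y)) := by
    have hlt : (X ++ a :: M).length < (X ++ a :: (M ++ b :: Y)).length := by simp
    have := (h.of_conflict hlt (by
      rw [getElem?_crossings_length, e, getElem?_crossings_length, hc])).2
    rw [e, eraseIdx_append_cons] at this
    simpa using this
  have h3 := h2.apply_lt_apply_succ
  rw [← List.append_assoc] at h1
  have h4 := h1.apply_lt_apply_succ
  have hs : ∀ x, zperm (X ++ M) x =
      Equiv.swap (zperm X a) (zperm X (a + 1)) (zperm (X ++ a :: M) x) := fun x => by
    rw [zperm_append_cons, Equiv.Perm.mul_apply, Equiv.swap_apply_self]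
  rw [hs, hs] at h4
  rcases Sym2.eq_iff.1 hc with ⟨e1, e2⟩ | h
  · rw [e1, e2, Equiv.swap_apply_left, Equiv.swap_apply_right] at h4
    omega
  · exact h

/-- When a bump lowers a letter, this letter exchanges values `x` and `y` before, and values `z`
and `x` afterwards; the value `x` is the same for all letters lowered in the course of the bump.
So `x` is the right one of the values exchanged by the letter lowered last. Moreover, the word
without the letter just lowered keeps its permutation. -/
theorem Settles.exists_split {n : ℕ} {y : List ℤ} {j : ℕ} {v : List ℤ} (h : Settles n y j v)
    (hy : NearlyReduced y j) {X Y : List ℤ} {a : ℤ} (hX : y = X ++ a :: Y) (hj : X.length = j) :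
    ∃ X' a' Y', v = X' ++ a' :: Y' ∧ zperm X' (a' + 1) = zperm X (a + 1) ∧
      zperm (X' ++ Y') = zperm (X ++ Y) ∧ ZReduced (X' ++ Y') := by
  induction h generalizing X a Y with
  | done y j h =>
    subst hX hj
    refine ⟨X, a, Y, rfl, rfl, rfl, ?_⟩
    have := hy.2
    rwa [eraseIdx_append_cons] at this
  | next n y j j' v h hlt hne hc hv ih =>
    have hy' := hy.of_conflict hlt hc
    have hperm := zperm_eraseIdx_eq hy.1 hc
    obtain ⟨X₁, b, Y₁, e₁, hj'⟩ := exists_eq_append_cons hlt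
    obtain ⟨X', a', Y', h1, h2, h3, h4⟩ := ih hy'.dec (X := X₁) (a := b - 1) (Y := Y₁)
      (by rw [← hj', e₁, dec_append_cons]) hj'
    have hc' : s(zperm X₁ b, zperm X₁ (b + 1)) = s(zperm X a, zperm X (a + 1)) := by
      have hA := getElem?_crossings_length X a Y
      have hB := getElem?_crossings_length X₁ b Y₁
      rw [← hX, hj] at hA
      rw [← e₁, hj', hc, hA] at hB
      exact (Option.some_inj.1 hB).symm
    have hp : zperm (X₁ ++ Y₁) = zperm (X ++ Y) := by
      rw [← zperm_eraseIdx_length X₁ b, ← zperm_eraseIdx_length X a, ← e₁, ← hX, hj, hj', hperm]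
    have hx : zperm X₁ b = zperm X (a + 1) := by
      have e := hX.symm.trans e₁
      rcases lt_or_gt_of_ne hne with hlt' | hlt'
      · obtain ⟨N, hN⟩ : X₁ <+: X := List.prefix_of_prefix_length_le (l₃ := y)
          ⟨_, e₁.symm⟩ ⟨_, hX.symm⟩ (by omega)
        subst hN
        rw [List.append_assoc, List.append_cancel_left_eq] at e
        cases N with
        | nil => simp at hj; omega
        | cons b' M =>
          obtain ⟨rfl, rfl⟩ := by simpa using e
          rw [e₁, ← hj'] at hy'
          exact (hy'.apply_eq hc'.symm).2.symm
      · obtain ⟨N, hN⟩ : X <+: X₁ := List.prefix_of_prefix_length_le (l₃ := y)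
          ⟨_, hX.symm⟩ ⟨_, e₁.symm⟩ (by omega)
        subst hN
        rw [List.append_assoc, List.append_cancel_left_eq] at e
        cases N with
        | nil => simp at hj'; omega
        | cons a' M =>
          obtain ⟨rfl, rfl⟩ := by simpa using e
          rw [hX, ← hj] at hy
          exact (hy.apply_eq hc').1
    exact ⟨X', a', Y', h1, by rw [h2, ← hx]; simp, by rw [h3, hp], h4⟩

/-! ### Covers -/

theorem swap_apply_other {x y c : ℤ} (h1 : c ≠ x) (h2 : c ≠ y) : Equiv.swap x y c = c :=
  Equiv.swap_apply_of_ne_of_ne h1 h2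

theorem map_mul_apply (σ τ : Equiv.Perm ℤ) (z : Sym2 ℤ) :
    Sym2.map (σ * τ) z = Sym2.map σ (Sym2.map τ z) := by
  rw [Sym2.map_map]
  rfl

/-- Removing a letter from a reduced word leaves a reduced word if no value between the two
exchanged ones stands between them in the permutation. -/
theorem ZReduced.zreduced_erase {X Y : List ℤ} {a : ℤ} (h : ZReduced (X ++ a :: Y)) {r s : ℤ}
    (hr : zperm (X ++ a :: Y) r = zperm X (a + 1)) (hs : zperm (X ++ a :: Y) s = zperm X a)
    (hrs : ∀ i, r < i → i < s → ¬ (zperm X a < zperm (X ++ a :: Y) i ∧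
      zperm (X ++ a :: Y) i < zperm X (a + 1))) : ZReduced (X ++ Y) := by
  have hxy := h.apply_lt_apply_succ
  have hX : ZReduced X := h.of_append_left
  have hY : ZReduced Y := ZReduced.of_append_right (X := X ++ [a]) (by simpa using h)
  have hmem : s(zperm X a, zperm X (a + 1)) ∈ crossings (X ++ a :: Y) := by
    simp [crossings_append_cons]
  have hinvxy := h.inverted_of_mem hmem
  have hcr := crossings_append_cons X a Y
  have hnd := h
  rw [ZReduced, hcr, List.nodup_append, List.nodup_cons, zperm_mul_zsimple] at hnd
  obtain ⟨-, -, hdisj⟩ := hnd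
  have hax : (zperm X)⁻¹ (zperm X a) = a := by simp
  have hay : (zperm X)⁻¹ (zperm X (a + 1)) = a + 1 := by simp
  set x := zperm X a with hx
  set y := zperm X (a + 1) with hy
  set σ := zperm (X ++ a :: Y) with hσ
  have hr' : σ⁻¹ y = r := by rw [← hr]; simp
  have hs' : σ⁻¹ x = s := by rw [← hs]; simp
  rw [ZReduced, crossings_append, List.nodup_append]
  refine ⟨hX, hY.map (map_injective _), ?_⟩
  rintro z hz z' hz' rfl
  obtain ⟨e, he, hez⟩ := List.mem_map.1 hz'
  induction z with | _ p q =>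
  have hpq := ne_of_mem_crossings hz
  have hmem2 : s(Equiv.swap x y p, Equiv.swap x y q) ∈
      (crossings Y).map (Sym2.map (Equiv.swap x y * zperm X)) := by
    refine List.mem_map.2 ⟨e, he, ?_⟩
    rw [map_mul_apply, hez, Sym2.map_mk]
  have i1 := hX.inverted_of_mem hz
  have i2 := h.inverted_of_mem (p := p) (q := q) (by rw [hcr]; simp [hz])
  have i4 := h.inverted_of_mem (p := Equiv.swap x y p) (q := Equiv.swap x y q) (by
    rw [hcr, zperm_mul_zsimple]
    exact List.mem_append_right _ (List.mem_cons_of_mem _ hmem2))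
  have i3 : ¬ Inverted (zperm X) (Equiv.swap x y p) (Equiv.swap x y q) := fun hi =>
    hdisj _ (mem_crossings_of_inverted (by simpa using hpq) hi) _
      (List.mem_cons_of_mem _ hmem2) rfl
  have key : ∀ c, c ≠ x → c ≠ y → (zperm X)⁻¹ c ≠ a ∧ (zperm X)⁻¹ c ≠ a + 1 ∧
      σ⁻¹ c ≠ r ∧ σ⁻¹ c ≠ s ∧ (σ⁻¹ c ≤ r ∨ s ≤ σ⁻¹ c ∨ c ≤ x ∨ y ≤ c) := by
    intro c h1 h2
    refine ⟨?_, ?_, ?_, ?_, ?_⟩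
    · rw [Ne, Equiv.Perm.inv_eq_iff_eq]; exact h1
    · rw [Ne, Equiv.Perm.inv_eq_iff_eq]; exact h2
    · rw [Ne, Equiv.Perm.inv_eq_iff_eq, hr]; exact h2
    · rw [Ne, Equiv.Perm.inv_eq_iff_eq, hs]; exact h1
    · by_contra hn
      push Not at hn
      exact hrs _ hn.1 hn.2.1 (by simpa using hn.2.2)
  simp only [Inverted, ← hσ] at i1 i2 i3 i4 hinvxy
  have hq := fun h1 h2 => key q h1 h2
  have hp := fun h1 h2 => key p h1 h2
  rcases eq_or_ne p x with rfl | p1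
  · rcases eq_or_ne q y with rfl | q2
    · rw [Equiv.swap_apply_left, Equiv.swap_apply_right] at i3
      omega
    · rw [Equiv.swap_apply_left, swap_apply_other hpq.symm q2] at i3 i4
      have := hq hpq.symm q2
      omega
  · rcases eq_or_ne p y with rfl | p2
    · rcases eq_or_ne q x with rfl | q1
      · rw [Equiv.swap_apply_left, Equiv.swap_apply_right] at i3
        omega
      · rw [Equiv.swap_apply_right, swap_apply_other q1 hpq.symm] at i3 i4
        have := hq q1 hpq.symm
        omega
    · have := hp p1 p2
      rw [swap_apply_other p1 p2] at i3 i4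
      rcases eq_or_ne q x with rfl | q1
      · rw [Equiv.swap_apply_left] at i3 i4
        omega
      · rcases eq_or_ne q y with rfl | q2
        · rw [Equiv.swap_apply_right] at i3 i4
          omega
        · rw [swap_apply_other q1 q2] at i3
          exact i3 i1

/-- If both a word and the word without one of its letters are reduced, then no value between
the two exchanged ones stands between them in the permutation. -/
theorem ZReduced.not_between {X Y : List ℤ} {a : ℤ} (h : ZReduced (X ++ a :: Y))
    (he : ZReduced (X ++ Y)) :
    (zperm (X ++ Y))⁻¹ (zperm X a) < (zperm (X ++ Y))⁻¹ (zperm X (a + 1)) ∧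
    ∀ i, (zperm (X ++ Y))⁻¹ (zperm X a) < i → i < (zperm (X ++ Y))⁻¹ (zperm X (a + 1)) →
      ¬ (zperm X a < zperm (X ++ Y) i ∧ zperm (X ++ Y) i < zperm X (a + 1)) := by
  have hxy := h.apply_lt_apply_succ
  have hcr := crossings_append_cons X a Y
  rw [zperm_mul_zsimple] at hcr
  have hperm := zperm_append_cons X a Y
  have hinv := h.inverted_of_mem (p := zperm X a) (q := zperm X (a + 1)) (by rw [hcr]; simp)
  have hce := crossings_append X Y
  set x := zperm X a with hx
  set y := zperm X (a + 1) with hy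
  set τ := zperm (X ++ Y) with hτ
  have hval : ∀ c, (zperm (X ++ a :: Y))⁻¹ c = τ⁻¹ (Equiv.swap x y c) := fun c => by
    rw [hperm]; simp
  simp only [Inverted, hval, Equiv.swap_apply_left, Equiv.swap_apply_right] at hinv
  have hne : τ⁻¹ x ≠ τ⁻¹ y := by simpa using hxy.ne
  refine ⟨by omega, fun i h1 h2 ⟨h3, h4⟩ => ?_⟩
  set c := τ i with hc
  have hci : τ⁻¹ c = i := by simp [hc]
  have m1 : s(x, c) ∈ crossings (X ++ a :: Y) := by
    refine mem_crossings_of_inverted h3.ne ?_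
    simp only [Inverted, hval, Equiv.swap_apply_left, swap_apply_other h3.ne' h4.ne, hci]
    omega
  have n1 : s(x, c) ∉ crossings (X ++ Y) := fun hm => by
    have := he.inverted_of_mem hm
    simp only [Inverted, ← hτ, hci] at this
    omega
  have n2 : s(y, c) ∉ crossings (X ++ Y) := fun hm => by
    have := he.inverted_of_mem hm
    simp only [Inverted, ← hτ, hci] at this
    omega
  rw [hce, List.mem_append, not_or] at n1 n2
  rw [hcr, List.mem_append, List.mem_cons] at m1
  rcases m1 with m1 | m1 | m1
  · exact n1.1 m1
  · rcases Sym2.eq_iff.1 m1 with m | m <;> omega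
  · obtain ⟨e, he1, he2⟩ := List.mem_map.1 m1
    refine n2.2 (List.mem_map.2 ⟨e, he1, ?_⟩)
    rw [map_mul_apply] at he2
    apply map_injective (Equiv.swap x y)
    rw [he2, Sym2.map_mk, Equiv.swap_apply_right, swap_apply_other h3.ne' h4.ne]

/-! ### The recursion of the Little map terminates -/

/-- One step of the Little map for integer words, at the last inversion `(r, s)`. Up to a
position `f < r` the permutation stays increasing; beyond `r` it stays increasing, too; and
among the positions beyond `r`, those from `s` on cease to form an inversion with `r`. -/
theorem ZReduced.exists_step {z : List ℤ} (hz : ZReduced z) {r s f : ℤ} (hrs : r < s)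
    (hinv : zperm z s < zperm z r) (hinc : ∀ x y, r < x → x < y → zperm z x < zperm z y)
    (hmax : ∀ x, s < x → zperm z r < zperm z x) (hfr : f < r)
    (hf : ∀ x y, x < y → y ≤ f → zperm z x < zperm z y) :
    ∃ i n v, (crossings z)[i]? = some s(zperm z r, zperm z s) ∧ NearlyReduced z i ∧
      Settles n (dec z i) i v ∧ (∀ x y, x < y → y ≤ f → zperm v x < zperm v y) ∧
      (∀ x y, r < x → x < y → zperm v x < zperm v y) ∧ ∀ x, s ≤ x → zperm v r < zperm v x := by
  have hmem : s(zperm z r, zperm z s) ∈ crossings z :=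
    mem_crossings_of_inverted hinv.ne' (by simp [Inverted]; omega)
  obtain ⟨i, hi⟩ := List.mem_iff_getElem?.1 hmem
  obtain ⟨X, a, Y, rfl, rfl, hpair⟩ := exists_split_of_getElem? hi
  have hlt := hz.apply_lt_apply_succ
  obtain ⟨ha, hb⟩ : zperm X a = zperm (X ++ a :: Y) s ∧
      zperm X (a + 1) = zperm (X ++ a :: Y) r := by
    rcases Sym2.eq_iff.1 hpair with ⟨h1, h2⟩ | h
    · omega
    · exact h
  have he : ZReduced (X ++ Y) := by
    refine hz.zreduced_erase hb.symm ha.symm fun i h1 h2 => ?_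
    have := hinc i s h1 h2
    omega
  have hn : NearlyReduced (X ++ a :: Y) X.length :=
    ⟨by simp, by rwa [eraseIdx_append_cons]⟩
  obtain ⟨n, v, hv⟩ := hn.dec.exists_settles
  have hv' := hv
  rw [dec_append_cons] at hv'
  obtain ⟨X', a', Y', rfl, hx', hperm, he'⟩ := hv'.exists_split (X := X) (a := a - 1) (Y := Y)
    (by rw [← dec_append_cons]; exact hn.dec) rfl rfl
  rw [sub_add_cancel] at hx'
  refine ⟨X.length, n, _, hi, hn, hv, ?_⟩
  have hvr := hv.zreduced
  obtain ⟨hqr, hcov⟩ := hvr.not_between he'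
  have hlt' := hvr.apply_lt_apply_succ
  have hσ' := zperm_append_cons X' a' Y'
  have hτ := zperm_erase_of_split (Y := Y) hpair
  rw [hx', ha, hperm] at hqr hcov hσ'
  rw [hx', ha] at hlt'
  set σ := zperm (X ++ a :: Y) with hσ
  set τ := zperm (X ++ Y) with hτ0
  set w := zperm X' a' with hw
  set σ' := zperm (X' ++ a' :: Y')
  have hτv : ∀ x, τ x = if x = r then σ s else if x = s then σ r else σ x := by
    intro x
    rw [hτ, Equiv.Perm.mul_apply, Equiv.swap_apply_def]
    simp only [EmbeddingLike.apply_eq_iff_eq]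
  have hτr' : τ r = σ s := by rw [hτv, if_pos rfl]
  have hτr : τ⁻¹ (σ s) = r := by rw [Equiv.Perm.inv_eq_iff_eq, hτr']
  rw [hτr] at hqr hcov
  set q := τ⁻¹ w with hq
  have hτq : τ q = w := by simp [hq]
  have hσv : ∀ x, σ' x = if x = q then σ s else if x = r then w else τ x := by
    intro x
    have h1 : τ x = w ↔ x = q := by rw [← hτq]; exact τ.injective.eq_iff
    have h2 : τ x = σ s ↔ x = r := by rw [← hτr']; exact τ.injective.eq_iff
    rw [hσ', Equiv.Perm.mul_apply, Equiv.swap_apply_def]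
    simp only [h1, h2]
  have hσq : σ q = w := by
    rw [← hτq, hτv, if_neg (by omega), if_neg (by omega)]
  refine ⟨fun x y hxy hy => ?_, fun x y hx hxy => ?_, fun x hx => ?_⟩
  · have h1 := hf x y hxy hy
    have hσx : σ' x = if x = q then σ s else σ x := by
      rw [hσv, hτv, if_neg (by omega : ¬ x = r), if_neg (by omega : ¬ x = r),
        if_neg (by omega : ¬ x = s)]
    have hσy : σ' y = if y = q then σ s else σ y := by
      rw [hσv, hτv, if_neg (by omega : ¬ y = r), if_neg (by omega : ¬ y = r),
        if_neg (by omega : ¬ y = s)]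
    rw [hσx, hσy]
    split_ifs with h2 h3 h3
    · omega
    · -- The value at `q` grows to `σ s`; no value on its way is met between `q` and `r`.
      subst h2
      have h4 := hcov y hxy (by omega)
      rw [hτv, if_neg (by omega), if_neg (by omega)] at h4
      have h5 : σ s ≠ σ y := fun h => by
        have := σ.injective h
        omega
      omega
    · subst h3
      omega
    · exact h1
  · have hσ1 : ∀ u, r < u → σ' u = if u = s then σ r else σ u := fun u hu => by
      rw [hσv, hτv, if_neg (by omega : ¬ u = q), if_neg (by omega : ¬ u = r),
        if_neg (by omega : ¬ u = r)]
    rw [hσ1 x hx, hσ1 y (by omega)]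
    split_ifs with h1 h2 h2
    · omega
    · exact hmax y (by omega)
    · have := hinc x y hx hxy
      rw [h2] at this
      omega
    · exact hinc x y hx hxy
  · rw [hσv r, if_neg (by omega), if_pos rfl, hσv, if_neg (by omega), if_neg (by omega), hτv,
      if_neg (by omega)]
    split_ifs with h1
    · omega
    · have := hmax x (by omega)
      omega

theorem BumpsTo.isReduced {u : List ℕ} {j : ℕ} {v : List ℕ} (h : BumpsTo u j v) :
    IsReduced v := by
  induction h with
  | done _ _ h => exact h
  | next _ _ _ _ _ _ _ _ _ ih => exact ih

theorem BumpsTo.length_eq {u : List ℕ} {j : ℕ} {v : List ℕ} (h : BumpsTo u j v) :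
    v.length = u.length := by
  induction h with
  | done => exact length_decrement _ _
  | next u j _ _ _ _ _ _ _ ih => rw [ih, length_decrement]

theorem perm_apply_of_gt {w : List ℕ} {N n : ℕ} (h : ∀ a ∈ w, a ≤ N) (hn : N + 1 < n) :
    perm w n = n := by
  induction w with
  | nil => rfl
  | cons a w ih =>
    have := h a (by simp)
    rw [perm_cons, Equiv.Perm.mul_apply, ih (fun b hb => h b (by simp [hb])), simple,
      Equiv.swap_apply_of_ne_of_ne (by omega) (by omega)]

theorem IsReduced.exists_isInversion {w : List ℕ} (hw : IsReduced w) (hne : w ≠ []) :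
    ∃ i j, IsInversion (perm w) i j := by
  obtain ⟨a, t, rfl⟩ := List.exists_cons_of_ne_nil hne
  have hinv := (hw.zreduced 0).inverted_of_mem (p := a) (q := a + 1) (by simp [shift])
  obtain ⟨P, hP⟩ : ∃ P, perm (a :: t) P = a + 1 := (perm (a :: t)).surjective _
  obtain ⟨Q, hQ⟩ : ∃ Q, perm (a :: t) Q = a := (perm (a :: t)).surjective _
  have hP' : (zperm (shift 0 (a :: t)))⁻¹ (a + 1) = P := by
    have := zperm_shift 0 (a :: t) P
    rw [add_zero, add_zero, hP] at this
    rw [Equiv.Perm.inv_eq_iff_eq, this]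
    simp
  have hQ' : (zperm (shift 0 (a :: t)))⁻¹ a = Q := by
    have := zperm_shift 0 (a :: t) Q
    rw [add_zero, add_zero, hQ] at this
    rw [Equiv.Perm.inv_eq_iff_eq, this]
  rw [Inverted, hP', hQ'] at hinv
  have hPQ : P ≠ Q := by rintro rfl; omega
  refine ⟨P, Q, ?_, by omega, by omega⟩
  rcases Nat.eq_zero_or_pos P with rfl | h
  · rw [perm_zero hw.1] at hP
    omega
  · exact h

open Classical in
theorem IsReduced.exists_isLastInversion {w : List ℕ} (hw : IsReduced w) (hne : w ≠ []) :
    ∃ r s, IsLastInversion (perm w) r s := by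
  obtain ⟨N, hN⟩ : ∃ N, ∀ a ∈ w, a ≤ N := by
    obtain ⟨N, hN⟩ := w.toFinset.bddAbove
    exact ⟨N, fun a ha => hN (by simpa using ha)⟩
  have hb : ∀ i j, IsInversion (perm w) i j → j < N + 2 := by
    rintro i j ⟨h1, h2, h3⟩
    by_contra hj
    rw [perm_apply_of_gt hN (by omega : N + 1 < j)] at h3
    have h4 := perm_apply_of_gt hN (by omega : N + 1 < perm w i)
    have := (perm w).injective h4
    omega
  let S := (Finset.range (N + 2) ×ˢ Finset.range (N + 2)).filter
    fun p => IsInversion (perm w) p.1 p.2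
  have hS : ∀ i j, IsInversion (perm w) i j → (i, j) ∈ S := by
    intro i j h
    have := hb i j h
    have := h.2.1
    simp only [S, Finset.mem_filter, Finset.mem_product, Finset.mem_range]
    exact ⟨⟨by omega, by omega⟩, h⟩
  obtain ⟨i, j, hij⟩ := hw.exists_isInversion hne
  obtain ⟨⟨r, s⟩, hrs, hmax⟩ := S.exists_max_image (fun p => toLex p) ⟨_, hS i j hij⟩
  refine ⟨r, s, (Finset.mem_filter.1 hrs).2, fun r' s' h => ?_⟩
  simpa [Prod.Lex.toLex_le_toLex] using hmax _ (hS r' s' h)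

theorem IsLastInversion.increasing {w : List ℕ} {r s : ℕ} (h : IsLastInversion (perm w) r s)
    (c : ℤ) (x y : ℤ) (hx : r + c < x) (hxy : x < y) :
    zperm (shift c w) x < zperm (shift c w) y := by
  obtain ⟨m, rfl⟩ : ∃ m : ℕ, x = m + c := ⟨(x - c).toNat, by omega⟩
  obtain ⟨n, rfl⟩ : ∃ n : ℕ, y = n + c := ⟨(y - c).toNat, by omega⟩
  rw [zperm_shift, zperm_shift]
  by_contra hc
  have hne : perm w m ≠ perm w n := fun h => by
    have := (perm w).injective h
    omega
  have := h.2 m n ⟨by omega, by omega, by omega⟩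
  omega

theorem IsLastInversion.lt_of_gt {w : List ℕ} {r s : ℕ} (h : IsLastInversion (perm w) r s)
    (c : ℤ) (x : ℤ) (hx : s + c < x) :
    zperm (shift c w) (r + c) < zperm (shift c w) x := by
  have hrs := h.1.2.1
  obtain ⟨m, rfl⟩ : ∃ m : ℕ, x = m + c := ⟨(x - c).toNat, by omega⟩
  rw [zperm_shift, zperm_shift]
  by_contra hc
  have hne : perm w m ≠ perm w r := fun h => by
    have := (perm w).injective h
    omega
  have := h.2 r m ⟨h.1.1, by omega, by omega⟩
  omega

theorem IsLastInversion.isGrassmannian {w : List ℕ} (hw : IsReduced w) {r s : ℕ}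
    (h : IsLastInversion (perm w) r s) {c : ℤ}
    (hf : ∀ x y, x < y → y ≤ r + c → zperm (shift c w) x < zperm (shift c w) y) :
    IsGrassmannian w := by
  have key : ∀ i, IsDescent (perm w) i → i = r := by
    intro i hi
    have h1 := h.2 i (i + 1) hi
    by_contra hne
    have h2 := hf (i + c) ((i + 1 : ℕ) + c) (by push_cast; omega) (by push_cast; omega)
    rw [zperm_shift, zperm_shift] at h2
    have := hi.2.2
    omega
  refine ⟨hw, r, ?_, key⟩
  by_contra hd
  have hne : perm w r ≠ perm w (r + 1) := by simp
  have h1 : perm w r < perm w (r + 1) := by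
    by_contra hc
    exact hd ⟨h.1.1, by omega, by omega⟩
  have h2 := h.1.2.1
  have h3 := h.1.2.2
  have h4 : r + 1 ≠ s := by
    rintro rfl
    omega
  have h5 := h.increasing c ((r + 1 : ℕ) + c) (s + c) (by push_cast; omega) (by push_cast; omega)
  rw [zperm_shift, zperm_shift] at h5
  omega

/-- The recursion terminates: in integer words, without renormalization, the last inversion
decreases lexicographically, and its first entry never drops below a position `f` up to which
the permutation is increasing at the beginning. -/
theorem exists_isLS_of_isLastInversion (f : ℤ) (A B : ℕ) {w : List ℕ} (hw : IsReduced w)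
    {r s : ℕ} (h : IsLastInversion (perm w) r s) {c : ℤ}
    (hf : ∀ x y, x < y → y ≤ f → zperm (shift c w) x < zperm (shift c w) y)
    (hA : r + c = f + A) (hB : s = r + B) : ∃ T, IsLS w T := by
  induction A using Nat.strong_induction_on generalizing B w r s c with
  | _ A ihA =>
  induction B using Nat.strong_induction_on generalizing w r s c with
  | _ B ihB =>
  by_cases hg : IsGrassmannian w
  · exact ⟨_, .grassmannian w hg⟩
  have hrs := h.1.2.1
  have hA0 : A ≠ 0 := by
    rintro rfl
    refine hg (h.isGrassmannian hw (c := c) ?_)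
    simpa [hA] using hf
  obtain ⟨i, n, v', hi, hn, hs, hf', hinc', hmax'⟩ := (hw.zreduced c).exists_step
    (r := r + c) (s := s + c) (f := f) (by omega)
    (by rw [zperm_shift, zperm_shift]; have := h.1.2.2; omega) (h.increasing c) (h.lt_of_gt c)
    (by omega) hf
  have hil : i < w.length := by simpa using hn.1
  obtain ⟨v, c', rfl, hb⟩ := hs.exists_bumpsTo c hw.1 hil rfl
  have hv := hb.isReduced
  have hsw : swapped w i = s(perm w r, perm w s) := by
    rw [crossings_shift c hil, zperm_shift, zperm_shift] at hi
    exact cast_add_injective c (by simpa using hi)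
  have hbump : IsLittleBump w i v := by
    refine ⟨hw, hil, (isReduced_iff c _).2 ⟨fun a ha => hw.1 a (List.mem_of_mem_eraseIdx ha), ?_⟩,
      hb⟩
    rw [shift_eraseIdx]
    exact hn.2
  suffices ∃ T, IsLS v T by
    obtain ⟨T, hT⟩ := this
    exact ⟨T, .bump w r s i v T hg h hsw hbump hT⟩
  have hne : v ≠ [] := by
    have := hb.length_eq
    rintro rfl
    simp at this
    omega
  obtain ⟨r₁, s₁, h₁⟩ := hv.exists_isLastInversion hne
  obtain ⟨h11, h12, h13⟩ := h₁.1
  have e1 := zperm_shift c' v r₁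
  have e2 := zperm_shift c' v s₁
  have hr₁ : r₁ + c' ≤ r + c := by
    by_contra hc
    have := hinc' (r₁ + c') (s₁ + c') (by omega) (by omega)
    omega
  have hfr : f ≤ r₁ + c' := by
    by_contra hc
    have h2 := hf' (r₁ + c') f (by omega) le_rfl
    obtain ⟨m, rfl⟩ : ∃ m : ℕ, f = m + c' := ⟨(f - c').toNat, by omega⟩
    have e3 := zperm_shift c' v m
    have h4 : m < s₁ := by
      by_contra hc'
      have := hf' (r₁ + c') (s₁ + c') (by omega) (by omega)
      omega
    have := h₁.2 m s₁ ⟨by omega, h4, by omega⟩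
    omega
  obtain ⟨A', hA'⟩ : ∃ A' : ℕ, (r₁ : ℤ) + c' = f + A' := ⟨(r₁ + c' - f).toNat, by omega⟩
  rcases lt_or_eq_of_le (by omega : A' ≤ A) with hlt | rfl
  · exact ihA A' hlt (s₁ - r₁) hv h₁ hf' hA' (by omega)
  · have hs₁ : s₁ + c' < s + c := by
      by_contra hc
      have := hmax' (s₁ + c') (by omega)
      rw [show (r : ℤ) + c = r₁ + c' by omega] at this
      omega
    exact ihB (s₁ - r₁) (by omega) hv h₁ hf' hA' (by omega)

theorem IsReduced.exists_isLS {w : List ℕ} (hw : IsReduced w) (hne : w ≠ []) :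
    ∃ T, IsLS w T := by
  obtain ⟨r, s, h⟩ := hw.exists_isLastInversion hne
  have h0 := zperm_shift 0 w 0
  rw [perm_zero hw.1] at h0
  have hfix : ∀ x : ℤ, x ≤ 0 → zperm (shift 0 w) x = x := by
    intro x hx
    rcases hx.lt_or_eq with hx | rfl
    · exact zperm_shift_of_lt w hx
    · simpa using h0
  refine exists_isLS_of_isLastInversion 0 r (s - r) hw h (c := 0) (fun x y hxy hy => ?_)
    (by omega) (by have := h.1.2.1; omega)
  rw [hfix x (by omega), hfix y hy]
  exact hxy

theorem IsLS.exists_bumps {w : List ℕ} {T : Tableau} (h : IsLS w T) :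
    ∃ v, Relation.ReflTransGen (fun x y => ∃ i, IsLittleBump x i y) w v ∧ IsGrassmannian v ∧
      T = tab v := by
  induction h with
  | grassmannian w h => exact ⟨w, .refl, h, rfl⟩
  | bump w r s i v T hw hrs hi hv hT ih =>
    obtain ⟨u, h1, h2, h3⟩ := ih
    exact ⟨u, h1.head ⟨i, hv⟩, h2, h3⟩

end Little

theorem mainTheorem4 (w v : List ℕ) (hw : Little.IsReduced w)
    (hbumps : Relation.ReflTransGen (fun x y => ∃ i, Little.IsLittleBump x i y) w v)
    (hv : Little.IsGrassmannian v) :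
    ∀ T : Little.Tableau, Little.IsLS w T ↔ T = Little.tab v := by
  have huniq : ∀ T, Little.IsLS w T → T = Little.tab v := by
    intro T hT
    obtain ⟨u, hu, hug, rfl⟩ := hT.exists_bumps
    exact hug.tab_eq hv (((Little.sameDescents_of_bumps hu 0 0).symm).trans
      (Little.sameDescents_of_bumps hbumps 0 0))
  refine fun T => ⟨huniq T, ?_⟩
  rintro rfl
  have hne : w ≠ [] := by
    rintro rfl
    have hl := (Little.sameDescents_of_bumps hbumps 0 0).1
    obtain rfl : v = [] := by simpa [eq_comm] using hl
    obtain ⟨k, hk, -⟩ := hv.2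
    have := hk.2.2
    simp [Little.perm] at this
  obtain ⟨T, hT⟩ := hw.exists_isLS hne
  exact huniq T hT ▸ hT
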